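/- Let $(E,\mathcal E,\mu)$ be a $\sigma$-finite atomless measure space with $\mu(E)=\infty$ (atomless: every measurable set of positive measure contains a measurable set of strictly smaller positive measure), and let $T:E\to E$ be measure preserving, ergodic and conservative. Let $\widehat T:L^1(\mu)\to L^1(\mu)$ be its transfer operator, $\widehat T g=\frac{d(\mu_g\circ T^{-1})}{d\mu}$ with $\mu_g(B)=\int_B g\,d\mu$. A sequence $(u_n)$ is called regularly varying with index $a$, written $(u_n)\in \mathrm{RV}_\infty(a)$, if $u_n>0$ for all large $n$ and $u_{\lfloor cn\rfloor}/u_n\to c^a$ for every $c>0$. Functions on a subset are extended by zero to the whole space. Let $A\in\mathcal E$ with $0<\mu(A)<\infty$ be equipped with a Polish topology whose Borel $\sigma$-field is $\mathcal E\cap A$, let $\beta\in(0,1)$ and let $(b_n)\in \mathrm{RV}_\infty(1-\beta)$ be such that, for every bounded $\mu$-a.e. continuous $g:A\to\mathbb R$, $$\lim_{n\to\infty} b_n\,\widehat T^n g(x)=\int_E g\,d\mu\quad\text{uniformly for a.e. }x\in A .$$ Let $\rho$ be a symmetric measure on $\mathbb R$ with $\rho(\{0\})=0$ and $\int x^2\,\rho(dx)=1$,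 and let $M$ be a random measure indexed by $\mathcal E_0=\{B\in\mathcal E:\mu(B)<\infty\}$ which is independently scattered (its values on disjoint sets are independent), $\sigma$-additive (for disjoint $B_n\in\mathcal E_0$ with $\bigcup_n B_n\in\mathcal E_0$, $M(\bigcup_n B_n)=\sum_n M(B_n)$ a.s.) and satisfies $$\mathbb E\, e^{iuM(B)}=\exp\Big(-\mu(B)\int_{\mathbb R}(1-\cos(uy))\,\rho(dy)\Big),\qquad u\in\mathbb R,\ B\in\mathcal E_0 .$$ For $p\ge1$ and $h\in L^2(\mu^p)$, where $\mu^p$ is the $p$-fold product measure, let $\int_{E^p}' h\,dM\cdots dM$ denote the off-diagonal multiple integral: it is linear, equals $M(B_1)\cdots M(B_p)$ when $h=1_{B_1\times\cdots\times B_p}$ with disjoint $B_i\in\mathcal E_0$, and is extended from linear combinations of such indicators by $L^2$ approximation. Let $p\ge1$, let $f:A^p\to\mathbb R$ be symmetric, bounded and $\mu^p$-a.e. continuous (for the product topology of $A^p$), extended by zero to $E^p$, put $T_p=T\times\cdots\times T$ ($p$ factors), $\mu^p(h)=\int_{E^p}h\,d\mu^p$, and $$X_k=\int_{E^p}' f(T^kx_1,\dots,T^kx_p)\,M(dx_1)\cdots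 M(dx_p),\qquad k=0,1,2,\dots$$ Then each $X_k$ is well defined in $L^2$, for every $k\ge 0$ $$\mathbb E[X_kX_0]=p!\,\mu^p\big((f\circ T_p^k)\cdot f\big),$$ and $$\lim_{k\to\infty} b_k^{p}\,\mathbb E[X_kX_0]=p!\,\mu^p(f)^2 .$$ In particular, if $\mu^p(f)\neq0$, then $\mathbb E[X_kX_0]\sim p!\,\mu^p(f)^2\,b_k^{-p}$ as $k\to\infty$ (the ratio tends to $1$), and both $(p!\,\mu^p(f)^2\,b_k^{-p})_k$ and $(\mathbb E[X_kX_0])_k$ belong to $\mathrm{RV}_\infty(p(\beta-1))$. -/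

import Mathlib

open MeasureTheory ProbabilityTheory Filter Topology
open scoped ENNReal Nat

namespace ErgodicChaos

noncomputable section

/-- A sequence is regularly varying at infinity with index `a`: it is (eventually) positive and
`u ⌊c n⌋ / u n → c ^ a` for every `c > 0`. -/
def RegularlyVarying (u : ℕ → ℝ) (a : ℝ) : Prop :=
  (∀ᶠ n in atTop, 0 < u n) ∧
    ∀ c : ℝ, 0 < c → Tendsto (fun n : ℕ => u ⌊c * (n : ℝ)⌋₊ / u n) atTop (𝓝 (c ^ a))

/-- A measure has no atoms in the measure-theoretic sense: each measurable set of positive measure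
contains a measurable set of strictly smaller positive measure. -/
def Atomless {E : Type*} [MeasurableSpace E] (μ : Measure E) : Prop :=
  ∀ B : Set E, MeasurableSet B → 0 < μ B →
    ∃ C : Set E, C ⊆ B ∧ MeasurableSet C ∧ 0 < μ C ∧ μ C < μ B

/-- The dual (Perron-Frobenius, transfer) operator: the Radon-Nikodym derivative with respect
to `μ` of the image under `T` of the signed measure `B ↦ ∫_B f dμ`. -/
def transfer {E : Type*} [MeasurableSpace E] (μ : Measure E) (T : E → E) (f : E → ℝ) : E → ℝ :=
  SignedMeasure.rnDeriv ((μ.withDensityᵥ f).map T) μ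

/-- Extension by zero of a function on `A` to the full space. -/
def extendZero {E : Type*} {A : Set E} (g : A → ℝ) : E → ℝ :=
  Function.extend (fun y : A => (y : E)) g 0

/-- Extension by zero of a function on `A ^ p` to the full space `E ^ p`. -/
def extendZeroPi {E : Type*} {A : Set E} {p : ℕ} (f : (Fin p → A) → ℝ) : (Fin p → E) → ℝ :=
  Function.extend (fun (y : Fin p → A) (i : Fin p) => (y i : E)) f 0

/-- The `k`-th iterate of the Cartesian product transform `T × ⋯ × T` on `E ^ p`. -/
def prodIter {E : Type*} (T : E → E) (p k : ℕ) : (Fin p → E) → (Fin p → E) :=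
  fun x i => T^[k] (x i)

/-- `b n * T̂ ^ n g → μ g` uniformly for almost every point of `A`, for each bounded,
`μ`-a.e. continuous function `g` on `A`, where continuity refers to the topology of `A`. -/
def UniformReturn {E : Type*} [MeasurableSpace E] (μ : Measure E) (T : E → E) (A : Set E)
    [TopologicalSpace A] (b : ℕ → ℝ) : Prop :=
  ∀ g : A → ℝ, (∃ K : ℝ, ∀ y, |g y| ≤ K) →
    (∀ᵐ y ∂(μ.comap (Subtype.val : A → E)), ContinuousAt g y) →
    ∀ ε : ℝ, 0 < ε → ∀ᶠ n in atTop, ∀ᵐ x ∂(μ.restrict A),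
      |b n * (transfer μ T)^[n] (extendZero g) x - ∫ z, extendZero g z ∂μ| < ε

/-- A symmetric Lévy measure on `ℝ` without mass at `0`, with unit second moment (which implies
the integrability of `min 1 (x ^ 2)`). -/
structure IsSymmUnitLevy (ρ : Measure ℝ) : Prop where
  zero : ρ {0} = 0
  symm : ρ.map (fun x => -x) = ρ
  second_moment : ∫⁻ x, ENNReal.ofReal (x ^ 2) ∂ρ = 1

/-- `M` is a (signed) infinitely divisible random measure with control measure `μ` and Lévy
measure `ρ`, without Gaussian part, indexed by the measurable sets of finite `μ`-measure.
The values of `M` on other sets are irrelevant. -/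
structure IsIDRandomMeasure {E Ω : Type*} [MeasurableSpace E] [MeasurableSpace Ω]
    (μ : Measure E) (ρ : Measure ℝ) (P : Measure Ω) (M : Set E → Ω → ℝ) : Prop where
  measurable : ∀ B, MeasurableSet B → μ B < ∞ → Measurable (M B)
  independent : ∀ B : ℕ → Set E, (∀ n, MeasurableSet (B n)) → (∀ n, μ (B n) < ∞) →
    Pairwise (fun m n => Disjoint (B m) (B n)) → iIndepFun (fun n => M (B n)) P
  sigma_additive : ∀ B : ℕ → Set E, (∀ n, MeasurableSet (B n)) → (∀ n, μ (B n) < ∞) →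
    Pairwise (fun m n => Disjoint (B m) (B n)) → μ (⋃ n, B n) < ∞ →
    ∀ᵐ ω ∂P, Tendsto (fun N : ℕ => ∑ n ∈ Finset.range N, M (B n) ω) atTop
      (𝓝 (M (⋃ n, B n) ω))
  char_fun : ∀ B, MeasurableSet B → μ B < ∞ → ∀ u : ℝ,
    ∫ ω, Complex.exp (Complex.I * ((u * M B ω : ℝ) : ℂ)) ∂P =
      ((Real.exp (-((μ B).toReal * ∫ y, (1 - Real.cos (u * y)) ∂ρ)) : ℝ) : ℂ)

/-- The pairs `(g, S)` of an elementary integrand `g` on `E ^ p` and its off-diagonal multiple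
integral `S` : the linear span of the pairs `(1_{B₁ × ⋯ × B_p}, M(B₁) ⋯ M(B_p))`, where the `Bᵢ`
are pairwise disjoint measurable sets of finite measure. -/
def elementaryIntegral {E Ω : Type*} [MeasurableSpace E]
    (μ : Measure E) (M : Set E → Ω → ℝ) (p : ℕ) :
    Submodule ℝ (((Fin p → E) → ℝ) × (Ω → ℝ)) :=
  Submodule.span ℝ {q | ∃ B : Fin p → Set E, (∀ i, MeasurableSet (B i)) ∧ (∀ i, μ (B i) < ∞) ∧
    Pairwise (fun i j => Disjoint (B i) (B j)) ∧
    q = ((Set.univ.pi B).indicator (fun _ => (1 : ℝ)), fun ω => ∏ i, M (B i) ω)}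

/-- `X` is a version of the off-diagonal multiple integral of `h ∈ L²(μ ^ p)`: the `L²(P)`-limit
of the integrals of elementary integrands which converge to `h` in `L²(μ ^ p)`. -/
def IsMultipleIntegral {E Ω : Type*} [MeasurableSpace E] [MeasurableSpace Ω]
    (μ : Measure E) (P : Measure Ω) (M : Set E → Ω → ℝ) {p : ℕ}
    (h : (Fin p → E) → ℝ) (X : Ω → ℝ) : Prop :=
  MemLp h 2 (Measure.pi fun _ : Fin p => μ) ∧ MemLp X 2 P ∧
    ∃ q : ℕ → ((Fin p → E) → ℝ) × (Ω → ℝ), (∀ n, q n ∈ elementaryIntegral μ M p) ∧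
      Tendsto (fun n => eLpNorm ((q n).1 - h) 2 (Measure.pi fun _ : Fin p => μ)) atTop (𝓝 0) ∧
      Tendsto (fun n => eLpNorm ((q n).2 - X) 2 P) atTop (𝓝 0)

open Classical in
/-- The off-diagonal multiple integral `∫' h(x₁, …, x_p) M(dx₁) ⋯ M(dx_p)`, as a random variable
defined up to null sets. -/
def multipleIntegral {E Ω : Type*} [MeasurableSpace E] [MeasurableSpace Ω]
    (μ : Measure E) (P : Measure Ω) (M : Set E → Ω → ℝ) {p : ℕ}
    (h : (Fin p → E) → ℝ) : Ω → ℝ :=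
  if hX : ∃ X : Ω → ℝ, IsMultipleIntegral μ P M h X then hX.choose else 0

end

end ErgodicChaos

namespace ErgodicChaos

/-! ### Duality for the transfer operator and renormalized returns of sets. -/

section Transfer

/-! The covariance is first turned into a deterministic return integral, which is then evaluated
through rectangles.

Covariance. The behaviour of the characteristic function near 0 makes `M B` centered with variance
`μ B` (`moments_of_charFun`). Given two products of values of `M` over disjoint families, cut all
the sets into the atoms of the algebra they generate. The values on the atoms are independent and
centered, so after expansion only pairs of monomials using the same atoms survive, and these are the
matchings of the two families by a permutation. Hence E[I(h) I(h')] = Σ_σ ∫ h · (h' ∘ σ) for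
elementary integrands (`integral_mul_of_mem_elementaryIntegral`), and the elementary integral is
bounded in L² by √(p!). Since `μ` is atomless, neighbourhoods of the diagonals can be made
negligible, so rectangles with disjoint sides are total in L² (`topologicalClosure_elementaryLp`).
The integral therefore exists for every square integrable h and the formula persists
(`IsMultipleIntegral.integral_mul`). For symmetric f the p! summands coincide.

Return. Integrating the uniform convergence over C gives b_n μ(T⁻ⁿC ∩ D) → μ(C) μ(D) when D has
negligible boundary (`tendsto_return`). For rectangles the return integral of T × ⋯ × T factors into
p of these, whence the power b_n^p. A bounded, almost everywhere continuous f is Riemann integrable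
with respect to such rectangles: |f - l| ≤ u pointwise, with l and u in their span and ∫ u small
(`exists_continuitySpan_approx`). Mere L¹ closeness could be lost against the factor b_n^p;
pointwise domination is not, because the error is bounded by return integrals of functions in the
span, whose renormalized limits are small.

Regular variation passes to powers and inverses and is stable under asymptotic equivalence. -/

theorem extendZero_indicator {E : Type*} {A D : Set E} :
    extendZero ((Subtype.val ⁻¹' D : Set A).indicator fun _ => (1 : ℝ)) =
      (A ∩ D).indicator fun _ => (1 : ℝ) := by
  classical
  funext x
  by_cases hx : x ∈ A
  · have := Subtype.val_injective.extend_apply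
      ((Subtype.val ⁻¹' D : Set A).indicator fun _ => (1 : ℝ)) 0 ⟨x, hx⟩
    simp only at this
    rw [extendZero, this]
    simp [Set.indicator, hx]
  · rw [extendZero, Function.extend_apply' _ _ _ (by rintro ⟨y, rfl⟩; exact hx y.2)]
    simp [hx]

variable {E : Type*} [MeasurableSpace E] {μ : Measure E} {T : E → E}

theorem integrable_transfer (g : E → ℝ) : Integrable (transfer μ T g) μ :=
  SignedMeasure.integrable_rnDeriv _ _

/-- Preimages of null sets are null, so the image measure is absolutely continuous and is recovered
from its Radon-Nikodym density. -/
theorem setIntegral_transfer [SigmaFinite μ] (hT : MeasurePreserving T μ μ) {g : E → ℝ}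
    (hg : Integrable g μ) {C : Set E} (hC : MeasurableSet C) :
    ∫ x in C, transfer μ T g x ∂μ = ∫ x in T ⁻¹' C, g x ∂μ := by
  have hac : (μ.withDensityᵥ g).map T ≪ᵥ μ.toENNRealVectorMeasure := by
    refine VectorMeasure.AbsolutelyContinuous.mk fun s hs h0 => ?_
    rw [Measure.toENNRealVectorMeasure_apply_measurable hs] at h0
    rw [VectorMeasure.map_apply _ hT.measurable hs,
      withDensityᵥ_apply hg (hT.measurable hs)]
    refine setIntegral_measure_zero _ ?_
    rw [hT.measure_preimage hs.nullMeasurableSet, h0]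
  have h := SignedMeasure.withDensityᵥ_rnDeriv_eq _ μ hac
  have h2 : (μ.withDensityᵥ (transfer μ T g)) C = ((μ.withDensityᵥ g).map T) C := by
    rw [← h]; rfl
  rw [withDensityᵥ_apply (integrable_transfer g) hC,
    VectorMeasure.map_apply _ hT.measurable hC,
    withDensityᵥ_apply hg (hT.measurable hC)] at h2
  exact h2

theorem integrable_transfer_iterate {g : E → ℝ} (hg : Integrable g μ) (n : ℕ) :
    Integrable ((transfer μ T)^[n] g) μ := by
  cases n with
  | zero => exact hg
  | succ n => rw [Function.iterate_succ_apply']; exact integrable_transfer _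

theorem setIntegral_transfer_iterate [SigmaFinite μ] (hT : MeasurePreserving T μ μ) {g : E → ℝ}
    (hg : Integrable g μ) {C : Set E} (hC : MeasurableSet C) (n : ℕ) :
    ∫ x in C, (transfer μ T)^[n] g x ∂μ = ∫ x in T^[n] ⁻¹' C, g x ∂μ := by
  induction n generalizing C with
  | zero => rfl
  | succ n ih =>
    rw [Function.iterate_succ_apply',
      setIntegral_transfer hT (integrable_transfer_iterate hg n) hC, ih (hT.measurable hC)]
    rw [← Set.preimage_comp, ← Function.iterate_succ' T n]

/-- A measurable part of `A` whose boundary in `A` is negligible. -/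
structure IsContinuitySet (μ : Measure E) (A : Set E) [TopologicalSpace A] (D : Set E) :
    Prop where
  subset : D ⊆ A
  measurable : MeasurableSet D
  frontier : μ.comap (Subtype.val : A → E) (frontier (Subtype.val ⁻¹' D : Set A)) = 0

theorem IsContinuitySet.inter {A : Set E} [TopologicalSpace A] {C D : Set E}
    (hC : IsContinuitySet μ A C) (hD : IsContinuitySet μ A D) : IsContinuitySet μ A (C ∩ D) where
  subset := Set.inter_subset_left.trans hC.subset
  measurable := hC.measurable.inter hD.measurable
  frontier := by
    rw [Set.preimage_inter]
    refine measure_mono_null (frontier_inter_subset _ _) (measure_union_null ?_ ?_)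
    · exact measure_mono_null Set.inter_subset_left hC.frontier
    · exact measure_mono_null Set.inter_subset_right hD.frontier

theorem isContinuitySet_self {A : Set E} [TopologicalSpace A] (hA : MeasurableSet A) :
    IsContinuitySet μ A A where
  subset := subset_rfl
  measurable := hA
  frontier := by simp

/-- Renormalized return probabilities between a measurable set and a continuity set. -/
theorem tendsto_return [SigmaFinite μ] (hT : MeasurePreserving T μ μ) {A : Set E}
    (hA : MeasurableSet A) (hA_fin : μ A < ∞) [TopologicalSpace A] {b : ℕ → ℝ}
    (hret : UniformReturn μ T A b) {C D : Set E} (hC : MeasurableSet C) (hCA : C ⊆ A)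
    (hD : IsContinuitySet μ A D) :
    Tendsto (fun n => b n * μ.real (T^[n] ⁻¹' C ∩ D)) atTop (𝓝 (μ.real C * μ.real D)) := by
  have hext : extendZero ((Subtype.val ⁻¹' D : Set A).indicator fun _ => (1 : ℝ)) =
      D.indicator fun _ => (1 : ℝ) := by
    rw [extendZero_indicator, Set.inter_eq_right.2 hD.subset]
  have hCfin : μ C < ∞ := (measure_mono hCA).trans_lt hA_fin
  have hDfin : μ D < ∞ := (measure_mono hD.subset).trans_lt hA_fin
  have hr := hret ((Subtype.val ⁻¹' D : Set A).indicator fun _ => (1 : ℝ))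
    ⟨1, fun y => by by_cases h : (y : E) ∈ D <;> simp [h]⟩ (by
      filter_upwards [measure_eq_zero_iff_ae_notMem.1 hD.frontier] with y hy
      exact (continuousOn_const (c := (1 : ℝ))).continuousAt_indicator hy)
  have hDint : Integrable (D.indicator fun _ => (1 : ℝ)) μ :=
    (integrable_indicator_iff hD.measurable).2 (integrableOn_const hDfin.ne)
  rw [hext, integral_indicator_const _ hD.measurable, smul_eq_mul, mul_one] at hr
  rw [Metric.tendsto_nhds]
  intro ε hε
  -- The summand 1 covers the case where `C` is null and makes the final inequality strict.
  have hpos : 0 < μ.real C + 1 := by positivity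
  filter_upwards [hr (ε / (μ.real C + 1)) (by positivity)] with n hn
  have h1 : μ.real (T^[n] ⁻¹' C ∩ D) =
      ∫ x in C, (transfer μ T)^[n] (D.indicator fun _ => (1 : ℝ)) x ∂μ := by
    rw [setIntegral_transfer_iterate hT hDint hC, setIntegral_indicator hD.measurable]
    simp
  have hint : IntegrableOn ((transfer μ T)^[n] (D.indicator fun _ => (1 : ℝ))) C μ :=
    (integrable_transfer_iterate hDint n).integrableOn
  have h2 : b n * μ.real (T^[n] ⁻¹' C ∩ D) - μ.real C * μ.real D =
      ∫ x in C, (b n * (transfer μ T)^[n] (D.indicator fun _ => (1 : ℝ)) x - μ.real D) ∂μ := by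
    rw [integral_sub (hint.const_mul _) (integrableOn_const hCfin.ne), integral_const_mul, h1]
    simp
  rw [Real.dist_eq, h2, ← Real.norm_eq_abs]
  have h3 := norm_setIntegral_le_of_norm_le_const_ae' (μ := μ) (s := C)
    (f := fun x => b n * (transfer μ T)^[n] (D.indicator fun _ => (1 : ℝ)) x - μ.real D)
    (C := ε / (μ.real C + 1)) hCfin (by
      rw [ae_restrict_iff' hA] at hn
      filter_upwards [hn] with x hx hxC
      exact (hx (hCA hxC)).le)
  refine h3.trans_lt ?_
  rw [div_mul_eq_mul_div, div_lt_iff₀ hpos]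
  nlinarith [measureReal_nonneg (μ := μ) (s := C)]

end Transfer

/-! ### Extension by zero, and transport from the powers of `A` to the powers of `E`. -/

section Retraction

variable {E : Type*} {A : Set E} {p : ℕ}

theorem extendZeroPi_of_mem (f : (Fin p → A) → ℝ) {r : E → A} (hr : ∀ a : A, r a = a)
    {x : Fin p → E} (hx : x ∈ Set.univ.pi fun _ => A) :
    extendZeroPi f x = f fun i => r (x i) := by
  have hinj : Function.Injective fun (y : Fin p → A) (i : Fin p) => (y i : E) := by
    intro y z h
    funext i
    exact Subtype.ext (congrFun h i)
  have h := hinj.extend_apply f 0 fun i => r (x i)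
  have h2 : (fun i => ((r (x i) : A) : E)) = x := by
    funext i
    exact congrArg Subtype.val (hr ⟨x i, hx i (Set.mem_univ i)⟩)
  simp only [h2] at h
  exact h

theorem extendZeroPi_of_notMem (f : (Fin p → A) → ℝ)
    {x : Fin p → E} (hx : x ∉ Set.univ.pi fun _ => A) : extendZeroPi f x = 0 := by
  rw [extendZeroPi, Function.extend_apply']
  · rfl
  · rintro ⟨y, rfl⟩
    exact hx fun i _ => (y i).2

theorem abs_extendZeroPi_le {f : (Fin p → A) → ℝ} {K : ℝ} (hf : ∀ y, |f y| ≤ K)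
    (x : Fin p → E) :
    |extendZeroPi f x| ≤ (Set.univ.pi fun _ => A).indicator (fun _ => K) x := by
  classical
  by_cases hx : x ∈ Set.univ.pi fun _ => A
  · have hinj : Function.Injective fun (y : Fin p → A) (i : Fin p) => (y i : E) := by
      intro y z h
      funext i
      exact Subtype.ext (congrFun h i)
    have h := hinj.extend_apply f 0 fun i => ⟨x i, hx i (Set.mem_univ i)⟩
    rw [Set.indicator_of_mem hx]
    refine le_of_eq_of_le ?_ (hf fun i => ⟨x i, hx i (Set.mem_univ i)⟩)
    rw [← h]
    rfl
  · rw [extendZeroPi_of_notMem f hx, Set.indicator_of_notMem hx, abs_zero]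

theorem extendZeroPi_comp_perm {f : (Fin p → A) → ℝ}
    (hf : ∀ (σ : Equiv.Perm (Fin p)) (y : Fin p → A), f (y ∘ σ) = f y)
    (σ : Equiv.Perm (Fin p)) (x : Fin p → E) : extendZeroPi f (x ∘ σ) = extendZeroPi f x := by
  classical
  by_cases hx : x ∈ Set.univ.pi fun _ => A
  · have hx' : x ∘ σ ∈ Set.univ.pi fun _ => A := fun i _ => hx (σ i) (Set.mem_univ _)
    -- If `A` is empty, a point of its power exists only for `p = 0`, where there is nothing to
    -- permute.
    rcases isEmpty_or_nonempty A with hA | ⟨⟨a0⟩⟩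
    · have : IsEmpty (Fin p) := ⟨fun i => hA.elim ⟨x i, hx i (Set.mem_univ i)⟩⟩
      congr 1
      exact Subsingleton.elim _ _
    · let r : E → A := fun z => if h : z ∈ A then ⟨z, h⟩ else a0
      have hr : ∀ a : A, r a = a := by intro a; simp [r]
      rw [extendZeroPi_of_mem f hr hx, extendZeroPi_of_mem f hr hx']
      exact hf σ fun i => r (x i)
  · have hx' : x ∘ σ ∉ Set.univ.pi fun _ => A := by
      intro h
      refine hx fun i _ => ?_
      simpa using h (σ.symm i) (Set.mem_univ _)
    rw [extendZeroPi_of_notMem f hx, extendZeroPi_of_notMem f hx']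

variable [MeasurableSpace E] {μ : Measure E}

/-- Points off `A` go to an arbitrary base point, which the restriction of `μ` to `A` does not see.
Composing with the retraction carries measurability and almost everywhere statements from `A` to
`E`. -/
theorem exists_retraction (hA : MeasurableSet A) (hne : A.Nonempty) :
    ∃ r : E → A, (∀ a : A, r a = a) ∧
      MeasurePreserving r (μ.restrict A) (μ.comap (Subtype.val : A → E)) := by
  classical
  obtain ⟨a0, ha0⟩ := hne
  let r : E → A := fun z => if h : z ∈ A then ⟨z, h⟩ else ⟨a0, ha0⟩
  have hr : ∀ a : A, r a = a := by intro a; simp [r]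
  have hm : Measurable r :=
    Measurable.dite (f := fun z : A => z) measurable_id measurable_const hA
  refine ⟨r, hr, hm, ?_⟩
  rw [← map_comap_subtype_coe hA, Measure.map_map hm measurable_subtype_coe]
  have : r ∘ (Subtype.val : A → E) = id := by funext a; exact hr a
  rw [this, Measure.map_id]

theorem isFiniteMeasure_comap_subtype (hA : MeasurableSet A) (hA_fin : μ A < ∞) :
    IsFiniteMeasure (μ.comap (Subtype.val : A → E)) :=
  ⟨by rw [comap_subtype_coe_apply hA, Set.image_univ, Subtype.range_coe]; exact hA_fin⟩

theorem measurePreserving_pi_retraction [SigmaFinite μ] {r : E → A} (hA : MeasurableSet A)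
    (hA_fin : μ A < ∞)
    (hr : MeasurePreserving r (μ.restrict A) (μ.comap (Subtype.val : A → E))) :
    MeasurePreserving (fun (x : Fin p → E) i => r (x i))
      ((Measure.pi fun _ : Fin p => μ).restrict (Set.univ.pi fun _ => A))
      (Measure.pi fun _ : Fin p => μ.comap (Subtype.val : A → E)) := by
  have := isFiniteMeasure_comap_subtype hA hA_fin
  rw [Measure.restrict_pi_pi]
  exact measurePreserving_pi _ _ fun _ => hr

/-- No Borel measurability of `f` is assumed: its continuity points form a Gδ set of full measure,
and `f` is continuous on that set. -/
theorem aestronglyMeasurable_extendZeroPi [SigmaFinite μ] (hA : MeasurableSet A)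
    (hA_fin : μ A < ∞) (hne : A.Nonempty) [TopologicalSpace A] [PolishSpace A] [BorelSpace A]
    {f : (Fin p → A) → ℝ}
    (hf : ∀ᵐ y ∂(Measure.pi fun _ : Fin p => μ.comap (Subtype.val : A → E)), ContinuousAt f y) :
    AEStronglyMeasurable (extendZeroPi f) (Measure.pi fun _ : Fin p => μ) := by
  obtain ⟨r, hr, hrm⟩ := exists_retraction (μ := μ) hA hne
  have hC : MeasurableSet {y | ContinuousAt f y} := (IsGδ.setOfPred_continuousAt f).measurableSet
  have h1 : AEStronglyMeasurable f (Measure.pi fun _ : Fin p => μ.comap (Subtype.val : A → E)) := by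
    have h := ContinuousOn.aestronglyMeasurable
      (μ := Measure.pi fun _ : Fin p => μ.comap (Subtype.val : A → E))
      (f := f) (s := {y | ContinuousAt f y}) (fun y hy => ContinuousAt.continuousWithinAt hy) hC
    rwa [Measure.restrict_eq_self_of_ae_mem (s := {y | ContinuousAt f y}) hf] at h
  have h2 := h1.comp_measurePreserving (measurePreserving_pi_retraction hA hA_fin hrm)
  have hQ : MeasurableSet (Set.univ.pi fun _ : Fin p => A) := MeasurableSet.univ_pi fun _ => hA
  rw [← aestronglyMeasurable_indicator_iff hQ] at h2
  refine h2.congr (Eventually.of_forall fun x => ?_)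
  by_cases hx : x ∈ Set.univ.pi fun _ => A
  · rw [Set.indicator_of_mem hx, extendZeroPi_of_mem f hr hx]; rfl
  · rw [Set.indicator_of_notMem hx, extendZeroPi_of_notMem f hx]

end Retraction

/-! ### The algebra spanned by continuity rectangles and its return asymptotics. -/

section RectangleSpan

variable {E : Type*} [MeasurableSpace E]

/-- Linear combinations of indicators of products of continuity sets. -/
def continuitySpan (μ : Measure E) (A : Set E) [TopologicalSpace A] (p : ℕ) :
    Submodule ℝ ((Fin p → E) → ℝ) :=
  Submodule.span ℝ {g | ∃ D : Fin p → Set E, (∀ i, IsContinuitySet μ A (D i)) ∧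
    g = (Set.univ.pi D).indicator fun _ => (1 : ℝ)}

variable {μ : Measure E} {A : Set E} [TopologicalSpace A] {p : ℕ}

theorem indicator_pi_mem_continuitySpan {D : Fin p → Set E} (hD : ∀ i, IsContinuitySet μ A (D i)) :
    ((Set.univ.pi D).indicator fun _ => (1 : ℝ)) ∈ continuitySpan μ A p :=
  Submodule.subset_span ⟨D, hD, rfl⟩

/-- Rectangles intersect coordinatewise. Closure under products is what puts differences and unions
of rectangles back in the span. -/
theorem mul_mem_continuitySpan {g h : (Fin p → E) → ℝ} (hg : g ∈ continuitySpan μ A p)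
    (hh : h ∈ continuitySpan μ A p) : g * h ∈ continuitySpan μ A p := by
  have hle : continuitySpan μ A p * continuitySpan μ A p ≤ continuitySpan μ A p := by
    rw [continuitySpan, Submodule.span_mul_span, Submodule.span_le]
    rintro _ ⟨_, ⟨C, hC, rfl⟩, _, ⟨D, hD, rfl⟩, rfl⟩
    refine Submodule.subset_span ⟨fun i => C i ∩ D i, fun i => (hC i).inter (hD i), ?_⟩
    funext x
    rw [Set.pi_inter_distrib]
    exact congrFun (Set.inter_indicator_one (M₀ := ℝ)).symm x
  exact hle (Submodule.mul_mem_mul hg hh)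

theorem indicator_diff_mem_continuitySpan {S U : Set (Fin p → E)}
    (hS : (S.indicator fun _ => (1 : ℝ)) ∈ continuitySpan μ A p)
    (hU : (U.indicator fun _ => (1 : ℝ)) ∈ continuitySpan μ A p) :
    ((S \ U).indicator fun _ => (1 : ℝ)) ∈ continuitySpan μ A p := by
  have h := Submodule.sub_mem _ hS (mul_mem_continuitySpan hS hU)
  convert h using 1
  funext x
  by_cases h1 : x ∈ S <;> by_cases h2 : x ∈ U <;> simp [h1, h2]

theorem indicator_union_mem_continuitySpan {S U : Set (Fin p → E)}
    (hS : (S.indicator fun _ => (1 : ℝ)) ∈ continuitySpan μ A p)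
    (hU : (U.indicator fun _ => (1 : ℝ)) ∈ continuitySpan μ A p) :
    ((S ∪ U).indicator fun _ => (1 : ℝ)) ∈ continuitySpan μ A p := by
  have h := Submodule.add_mem _ (indicator_diff_mem_continuitySpan hS hU) hU
  convert h using 1
  funext x
  by_cases h1 : x ∈ S <;> by_cases h2 : x ∈ U <;> simp [h1, h2]

theorem IsContinuitySet.measure_lt_top {D : Set E} (hD : IsContinuitySet μ A D)
    (hA_fin : μ A < ∞) : μ D < ∞ :=
  (measure_mono hD.subset).trans_lt hA_fin

theorem integrable_indicator_pi [SigmaFinite μ] {D : Fin p → Set E}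
    (hD : ∀ i, MeasurableSet (D i)) (hfin : ∀ i, μ (D i) < ∞) :
    Integrable ((Set.univ.pi D).indicator fun _ => (1 : ℝ)) (Measure.pi fun _ : Fin p => μ) := by
  rw [integrable_indicator_iff (MeasurableSet.univ_pi hD)]
  refine integrableOn_const ?_
  rw [Measure.pi_pi]
  exact (ENNReal.prod_lt_top fun i _ => hfin i).ne

theorem integral_indicator_pi [SigmaFinite μ] {D : Fin p → Set E}
    (hD : ∀ i, MeasurableSet (D i)) :
    ∫ x, (Set.univ.pi D).indicator (fun _ => (1 : ℝ)) x ∂(Measure.pi fun _ : Fin p => μ) =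
      ∏ i, μ.real (D i) := by
  rw [integral_indicator_const _ (MeasurableSet.univ_pi hD), smul_eq_mul, mul_one,
    measureReal_def, Measure.pi_pi, ENNReal.toReal_prod]
  rfl

theorem integrable_of_mem_continuitySpan [SigmaFinite μ] (hA_fin : μ A < ∞)
    {g : (Fin p → E) → ℝ} (hg : g ∈ continuitySpan μ A p) :
    Integrable g (Measure.pi fun _ : Fin p => μ) := by
  induction hg using Submodule.span_induction with
  | mem g hg =>
    obtain ⟨D, hD, rfl⟩ := hg
    exact integrable_indicator_pi (fun i => (hD i).measurable)
      fun i => (hD i).measure_lt_top hA_fin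
  | zero => exact integrable_zero _ _ _
  | add g h _ _ hg hh => exact hg.add hh
  | smul c g _ hg => exact hg.smul c

theorem measurePreserving_prodIter [SigmaFinite μ] {T : E → E} (hT : MeasurePreserving T μ μ)
    (k : ℕ) : MeasurePreserving (prodIter T p k) (Measure.pi fun _ : Fin p => μ)
      (Measure.pi fun _ : Fin p => μ) :=
  measurePreserving_pi _ _ fun _ => hT.iterate k

/-- On two rectangles the integral is a product over coordinates, each absorbing one factor `b n`;
bilinearity does the rest. Integrability is part of the induction because additivity of the integral
needs it. -/
theorem tendsto_return_continuitySpan [SigmaFinite μ] {T : E → E}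
    (hT : MeasurePreserving T μ μ) (hA : MeasurableSet A) (hA_fin : μ A < ∞) {b : ℕ → ℝ}
    (hret : UniformReturn μ T A b) {g h : (Fin p → E) → ℝ} (hg : g ∈ continuitySpan μ A p)
    (hh : h ∈ continuitySpan μ A p) :
    (∀ n, Integrable (fun x => g (prodIter T p n x) * h x) (Measure.pi fun _ : Fin p => μ)) ∧
    Tendsto (fun n => b n ^ p *
        ∫ x, g (prodIter T p n x) * h x ∂(Measure.pi fun _ : Fin p => μ)) atTop
      (𝓝 ((∫ x, g x ∂(Measure.pi fun _ : Fin p => μ)) *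
        ∫ x, h x ∂(Measure.pi fun _ : Fin p => μ))) := by
  induction hg using Submodule.span_induction with
  | mem g hg =>
    obtain ⟨C, hC, rfl⟩ := hg
    induction hh using Submodule.span_induction with
    | mem h hh =>
      obtain ⟨D, hD, rfl⟩ := hh
      have hm : ∀ n i, MeasurableSet (T^[n] ⁻¹' C i ∩ D i) := fun n i =>
        (((hT.iterate n).measurable (hC i).measurable).inter (hD i).measurable)
      have heq : ∀ n, (fun x => (Set.univ.pi C).indicator (fun _ => (1 : ℝ)) (prodIter T p n x) *
          (Set.univ.pi D).indicator (fun _ => (1 : ℝ)) x) =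
          (Set.univ.pi fun i => T^[n] ⁻¹' C i ∩ D i).indicator fun _ => (1 : ℝ) := by
        intro n
        funext x
        rw [Set.pi_inter_distrib]
        refine Eq.trans ?_ (congrFun (Set.inter_indicator_one (M₀ := ℝ)).symm x)
        rfl
      constructor
      · intro n
        rw [heq]
        exact integrable_indicator_pi (hm n) fun i =>
          (measure_mono Set.inter_subset_right).trans_lt ((hD i).measure_lt_top hA_fin)
      · simp only [heq, integral_indicator_pi (hm _)]
        rw [integral_indicator_pi fun i => (hC i).measurable,
          integral_indicator_pi fun i => (hD i).measurable, ← Finset.prod_mul_distrib]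
        have : ∀ n, b n ^ p * ∏ i, μ.real (T^[n] ⁻¹' C i ∩ D i) =
            ∏ i, (b n * μ.real (T^[n] ⁻¹' C i ∩ D i)) := by
          intro n
          rw [Finset.prod_mul_distrib, Finset.prod_const, Finset.card_univ, Fintype.card_fin]
        simp only [this]
        exact tendsto_finsetProd _ fun i _ =>
          tendsto_return hT hA hA_fin hret (hC i).measurable (hC i).subset (hD i)
    | zero => simp
    | add h₁ h₂ m₁ m₂ ih₁ ih₂ =>
      constructor
      · intro n
        simp only [Pi.add_apply, mul_add]
        exact (ih₁.1 n).add (ih₂.1 n)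
      · have h := ih₁.2.add ih₂.2
        rw [← mul_add, ← integral_add (integrable_of_mem_continuitySpan hA_fin m₁)
          (integrable_of_mem_continuitySpan hA_fin m₂)] at h
        refine h.congr fun n => ?_
        rw [← mul_add, ← integral_add (ih₁.1 n) (ih₂.1 n)]
        simp only [Pi.add_apply, mul_add]
    | smul c h m ih =>
      constructor
      · intro n
        simpa only [Pi.smul_apply, smul_eq_mul, mul_left_comm _ c] using (ih.1 n).const_mul c
      · simpa only [Pi.smul_apply, smul_eq_mul, mul_left_comm _ c, integral_const_mul]
          using ih.2.const_mul c
  | zero => simp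
  | add g₁ g₂ m₁ m₂ ih₁ ih₂ =>
    constructor
    · intro n
      simp only [Pi.add_apply, add_mul]
      exact (ih₁.1 n).add (ih₂.1 n)
    · have h := ih₁.2.add ih₂.2
      rw [← add_mul, ← integral_add (integrable_of_mem_continuitySpan hA_fin m₁)
        (integrable_of_mem_continuitySpan hA_fin m₂)] at h
      refine h.congr fun n => ?_
      rw [← mul_add, ← integral_add (ih₁.1 n) (ih₂.1 n)]
      simp only [Pi.add_apply, add_mul]
  | smul c g m ih =>
    constructor
    · intro n
      simpa only [Pi.smul_apply, smul_eq_mul, mul_assoc] using (ih.1 n).const_mul c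
    · simpa only [Pi.smul_apply, smul_eq_mul, mul_left_comm _ c, mul_assoc, integral_const_mul]
        using ih.2.const_mul c

end RectangleSpan

/-! ### Riemann approximation by continuity rectangles. -/

section Approximation

variable {E : Type*} [MeasurableSpace E] {μ : Measure E} {A : Set E} [TopologicalSpace A] {p : ℕ}

/-- Every neighbourhood in `A ^ p` contains a neighbourhood which is a product of open continuity
sets. -/
theorem exists_pi_continuitySet_subset [PolishSpace A] [BorelSpace A] (hA : MeasurableSet A)
    (hA_fin : μ A < ∞) {y : Fin p → A} {U : Set (Fin p → A)} (hU : U ∈ 𝓝 y) :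
    ∃ D : Fin p → Set E, (∀ i, IsContinuitySet μ A (D i)) ∧
      {z : Fin p → A | ∀ i, (z i : E) ∈ D i} ∈ 𝓝 y ∧
      {z : Fin p → A | ∀ i, (z i : E) ∈ D i} ⊆ U := by
  let _ := TopologicalSpace.metrizableSpaceMetric A
  have := isFiniteMeasure_comap_subtype hA hA_fin
  obtain ⟨δ, hδ, hball⟩ := Metric.mem_nhds_iff.1 hU
  -- Boundaries of concentric balls of different radii are disjoint, so a finite measure charges
  -- only countably many of them.
  have hex : ∀ i, ∃ r ∈ Set.Ioo 0 δ,
      μ.comap (Subtype.val : A → E) (frontier (Metric.ball (y i) r)) = 0 := by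
    intro i
    obtain ⟨r, hr, h0⟩ :=
      exists_null_frontier_thickening (μ.comap (Subtype.val : A → E)) {y i} hδ
    rw [Metric.thickening_singleton] at h0
    exact ⟨r, hr, h0⟩
  choose r hr h0 using hex
  have hpre : ∀ i, Subtype.val ⁻¹' (Subtype.val '' Metric.ball (y i) (r i) : Set E) =
      Metric.ball (y i) (r i) := fun i => Set.preimage_image_eq _ Subtype.val_injective
  have hset : {z : Fin p → A | ∀ i, (z i : E) ∈ (Subtype.val '' Metric.ball (y i) (r i) : Set E)} =
      Set.univ.pi fun i => Metric.ball (y i) (r i) := by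
    ext z
    simp
  refine ⟨fun i => Subtype.val '' Metric.ball (y i) (r i), fun i => ⟨?_, ?_, ?_⟩, ?_, ?_⟩
  · rintro _ ⟨z, _, rfl⟩
    exact z.2
  · exact hA.subtype_image measurableSet_ball
  · rw [hpre]
    exact h0 i
  · rw [hset]
    exact set_pi_mem_nhds Set.finite_univ fun i _ => Metric.ball_mem_nhds _ (hr i).1
  · rw [hset]
    refine Set.Subset.trans (fun z hz => ?_) hball
    rw [Metric.mem_ball, dist_pi_lt_iff hδ]
    exact fun i => (Metric.mem_ball.1 (hz i (Set.mem_univ i))).trans (hr i).2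

/-- Each continuity point has a rectangular neighbourhood on which `f` varies by at most `ε`; the
Lindelöf property leaves countably many of them, and what they miss is null. -/
theorem exists_cover_of_ae_continuousAt [SigmaFinite μ] [PolishSpace A] [BorelSpace A]
    (hA : MeasurableSet A) (hA_fin : μ A < ∞) (hne : A.Nonempty) {f : (Fin p → A) → ℝ}
    (hf : ∀ᵐ y ∂(Measure.pi fun _ : Fin p => μ.comap (Subtype.val : A → E)), ContinuousAt f y)
    {ε : ℝ} (hε : 0 < ε) :
    ∃ (S : ℕ → Set (Fin p → E)) (c : ℕ → ℝ),
      (∀ n, ((S n).indicator fun _ => (1 : ℝ)) ∈ continuitySpan μ A p) ∧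
      (∀ n, MeasurableSet (S n)) ∧ (∀ n, S n ⊆ Set.univ.pi fun _ => A) ∧
      (∀ n, ∀ x ∈ S n, |extendZeroPi f x - c n| ≤ ε) ∧
      (Measure.pi fun _ : Fin p => μ) ((Set.univ.pi fun _ => A) \ ⋃ n, S n) = 0 := by
  classical
  obtain ⟨r, hr, hrm⟩ := exists_retraction (μ := μ) hA hne
  have hloc : ∀ y : Fin p → A, ∃ D : Fin p → Set E, ContinuousAt f y →
      (∀ i, IsContinuitySet μ A (D i)) ∧ {z : Fin p → A | ∀ i, (z i : E) ∈ D i} ∈ 𝓝 y ∧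
      ∀ z : Fin p → A, (∀ i, (z i : E) ∈ D i) → |f z - f y| ≤ ε := by
    intro y
    by_cases hy : ContinuousAt f y
    · obtain ⟨D, hD, hn, hsub⟩ := exists_pi_continuitySet_subset hA hA_fin
        (hy (Metric.closedBall_mem_nhds (f y) hε))
      exact ⟨D, fun _ => ⟨hD, hn, fun z hz => hsub hz⟩⟩
    · exact ⟨fun _ => ∅, fun h => (hy h).elim⟩
  choose D hD using hloc
  obtain ⟨t, htC, htc, hcov⟩ := TopologicalSpace.countable_cover_nhdsWithin
    (s := {y | ContinuousAt f y}) (f := fun y => {z : Fin p → A | ∀ i, (z i : E) ∈ D y i})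
    fun y hy => mem_nhdsWithin_of_mem_nhds (hD y hy).2.1
  let _ := htc.toEncodable
  let S : ℕ → Set (Fin p → E) := fun n =>
    match Encodable.decode (α := t) n with
    | some y => Set.univ.pi (D y)
    | none => ∅
  let c : ℕ → ℝ := fun n =>
    match Encodable.decode (α := t) n with
    | some y => f y
    | none => 0
  have hcases : ∀ n, (∃ y : t, S n = Set.univ.pi (D y) ∧ c n = f y) ∨ S n = ∅ := by
    intro n
    simp only [S, c]
    cases h : Encodable.decode (α := t) n with
    | some y => exact Or.inl ⟨y, rfl, rfl⟩
    | none => exact Or.inr rfl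
  have hsub : ∀ n, S n ⊆ Set.univ.pi fun _ => A := by
    intro n
    rcases hcases n with ⟨y, h, -⟩ | h
    · rw [h]
      exact Set.pi_mono fun i _ => ((hD y (htC y.2)).1 i).subset
    · rw [h]
      exact Set.empty_subset _
  have hmeas : ∀ n, MeasurableSet (S n) := by
    intro n
    rcases hcases n with ⟨y, h, -⟩ | h
    · rw [h]
      exact MeasurableSet.univ_pi fun i => ((hD y (htC y.2)).1 i).measurable
    · rw [h]
      exact MeasurableSet.empty
  refine ⟨S, c, fun n => ?_, hmeas, hsub, fun n x hx => ?_, ?_⟩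
  · rcases hcases n with ⟨y, h, -⟩ | h
    · rw [h]
      exact indicator_pi_mem_continuitySpan (hD y (htC y.2)).1
    · rw [h, Set.indicator_empty]
      exact Submodule.zero_mem _
  · have hxA := hsub n hx
    rcases hcases n with ⟨y, h, hc⟩ | h
    · rw [hc, extendZeroPi_of_mem f hr hxA]
      refine (hD y (htC y.2)).2.2 _ fun i => ?_
      rw [h] at hx
      have : ((r (x i) : A) : E) = x i := congrArg Subtype.val (hr ⟨x i, hxA i (Set.mem_univ i)⟩)
      rw [this]
      exact hx i (Set.mem_univ i)
    · rw [h] at hx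
      exact hx.elim
  · have hQ : MeasurableSet (Set.univ.pi fun _ : Fin p => A) := MeasurableSet.univ_pi fun _ => hA
    have h1 := (measurePreserving_pi_retraction hA hA_fin hrm).quasiMeasurePreserving.ae hf
    rw [ae_restrict_iff' hQ] at h1
    refine measure_mono_null (fun x hx => ?_) (ae_iff.1 h1)
    rw [Set.mem_ofPred_eq]
    intro hcon
    have hcx := hcov (hcon hx.1)
    rw [Set.mem_iUnion₂] at hcx
    obtain ⟨y, hy, hyx⟩ := hcx
    refine hx.2 (Set.mem_iUnion.2 ⟨Encodable.encode (⟨y, hy⟩ : t), ?_⟩)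
    simp only [S, Encodable.encodek]
    intro i _
    have : ((r (x i) : A) : E) = x i := congrArg Subtype.val (hr ⟨x i, hx.1 i (Set.mem_univ i)⟩)
    rw [← this]
    exact hyx i

/-- Bounded almost everywhere continuous functions are Riemann integrable with respect to
continuity rectangles. -/
theorem exists_continuitySpan_approx [SigmaFinite μ] [PolishSpace A] [BorelSpace A]
    (hA : MeasurableSet A) (hA_fin : μ A < ∞) (hne : A.Nonempty) {f : (Fin p → A) → ℝ} {K : ℝ}
    (hK : ∀ y, |f y| ≤ K)
    (hf : ∀ᵐ y ∂(Measure.pi fun _ : Fin p => μ.comap (Subtype.val : A → E)), ContinuousAt f y)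
    {ε : ℝ} (hε : 0 < ε) :
    ∃ l ∈ continuitySpan μ A p, ∃ u ∈ continuitySpan μ A p,
      (∀ x, |extendZeroPi f x - l x| ≤ u x) ∧
      ∫ x, u x ∂(Measure.pi fun _ : Fin p => μ) ≤ ε := by
  classical
  set Q : Set (Fin p → E) := Set.univ.pi fun _ => A with hQdef
  set m : Measure (Fin p → E) := Measure.pi fun _ : Fin p => μ with hm
  have hQ : MeasurableSet Q := MeasurableSet.univ_pi fun _ => hA
  have hQfin : m Q < ∞ := by
    rw [hm, hQdef, Measure.pi_pi]
    exact ENNReal.prod_lt_top fun _ _ => hA_fin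
  have hQmem : (Q.indicator fun _ => (1 : ℝ)) ∈ continuitySpan μ A p :=
    indicator_pi_mem_continuitySpan fun _ => isContinuitySet_self hA
  have hK0 : 0 ≤ K := by
    obtain ⟨a, ha⟩ := hne
    exact (abs_nonneg _).trans (hK fun _ => ⟨a, ha⟩)
  -- Error budget: oscillation at most `η` on all of `Q`, plus the bound `K` on an uncovered part of
  -- mass at most `η`.
  obtain ⟨η, hη, hηle⟩ : ∃ η : ℝ, 0 < η ∧ η * m.real Q + K * η ≤ ε := by
    have hpos : 0 < m.real Q + K + 1 := by positivity
    refine ⟨ε / (m.real Q + K + 1), by positivity, ?_⟩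
    rw [div_mul_eq_mul_div, mul_div_assoc', ← add_div, div_le_iff₀ hpos]
    nlinarith
  obtain ⟨S, c, hS, hSm, hSQ, hSc, hnull⟩ :=
    exists_cover_of_ae_continuousAt hA hA_fin hne hf hη
  let U : ℕ → Set (Fin p → E) := fun N => ⋃ n ∈ Finset.range N, S n
  have hUsucc : ∀ N, U (N + 1) = U N ∪ S N := by
    intro N
    simp only [U, Finset.range_add_one, Finset.set_biUnion_insert]
    exact Set.union_comm _ _
  have hUm : ∀ N, MeasurableSet (U N) := fun N => Finset.measurableSet_biUnion _ fun n _ => hSm n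
  have hUmem : ∀ N, ((U N).indicator fun _ => (1 : ℝ)) ∈ continuitySpan μ A p := by
    intro N
    induction N with
    | zero =>
      simp only [U, Finset.range_zero, Finset.notMem_empty, Set.iUnion_false, Set.iUnion_empty,
        Set.indicator_empty]
      exact Submodule.zero_mem _
    | succ N ih =>
      rw [hUsucc]
      exact indicator_union_mem_continuitySpan ih (hS N)
  -- The step function takes the value `c N` only on the part of `S N` not covered before, so
  -- earlier estimates are not disturbed.
  have hstep : ∀ N, ∃ l ∈ continuitySpan μ A p, (∀ x ∈ U N, |extendZeroPi f x - l x| ≤ η) ∧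
      ∀ x ∉ U N, l x = 0 := by
    intro N
    induction N with
    | zero => exact ⟨0, Submodule.zero_mem _, by simp [U], by simp⟩
    | succ N ih =>
      obtain ⟨l, hl, hl1, hl2⟩ := ih
      refine ⟨l + c N • (S N \ U N).indicator fun _ => (1 : ℝ), Submodule.add_mem _ hl
        (Submodule.smul_mem _ _ (indicator_diff_mem_continuitySpan (hS N) (hUmem N))), ?_, ?_⟩
      · intro x hx
        by_cases hxU : x ∈ U N
        · simpa [hxU] using hl1 x hxU
        · have hxS : x ∈ S N := by
            rw [hUsucc] at hx
            exact hx.resolve_left hxU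
          simpa [hxU, hxS, hl2 x hxU] using hSc N x hxS
      · intro x hx
        rw [hUsucc, Set.mem_union, not_or] at hx
        simp [hx.1, hx.2, hl2 x hx.1]
  have hUnion : ⋃ N, U N = ⋃ n, S n := by
    ext x
    simp only [U, Set.mem_iUnion, Finset.mem_range]
    exact ⟨fun ⟨_, n, _, h⟩ => ⟨n, h⟩, fun ⟨n, h⟩ => ⟨n + 1, n, Nat.lt_succ_self n, h⟩⟩
  have hUmono : Monotone U := by
    refine monotone_nat_of_le_succ fun N => ?_
    rw [hUsucc]
    exact Set.subset_union_left
  have hlim : Tendsto (fun N => m (Q \ U N)) atTop (𝓝 0) := by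
    have h := tendsto_measure_iInter_atTop (μ := m) (s := fun N => Q \ U N)
      (fun N => (hQ.diff (hUm N)).nullMeasurableSet)
      (fun a b hab => Set.sdiff_subset_sdiff_right (hUmono hab))
      ⟨0, ((measure_mono Set.sdiff_subset).trans_lt hQfin).ne⟩
    rwa [← Set.sdiff_iUnion, hUnion, hnull] at h
  obtain ⟨N, hN⟩ := (hlim.eventually (gt_mem_nhds (ENNReal.ofReal_pos.2 hη))).exists
  obtain ⟨l, hl, hl1, hl2⟩ := hstep N
  have hdmem := indicator_diff_mem_continuitySpan hQmem (hUmem N)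
  have hQint := integrable_of_mem_continuitySpan hA_fin hQmem
  have hdint := integrable_of_mem_continuitySpan hA_fin hdmem
  -- Off `U N` the approximant vanishes, so the error there is at most the sup bound `K`.
  refine ⟨l, hl, η • (Q.indicator fun _ => (1 : ℝ)) + K • (Q \ U N).indicator fun _ => (1 : ℝ),
    Submodule.add_mem _ (Submodule.smul_mem _ _ hQmem) (Submodule.smul_mem _ _ hdmem),
    fun x => ?_, ?_⟩
  · simp only [Pi.add_apply, Pi.smul_apply, smul_eq_mul]
    by_cases hxU : x ∈ U N
    · have hxQ : x ∈ Q := by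
        simp only [U, Set.mem_iUnion] at hxU
        obtain ⟨n, _, h⟩ := hxU
        exact hSQ n h
      simpa [hxU, hxQ] using hl1 x hxU
    · rw [hl2 x hxU, sub_zero]
      refine (abs_extendZeroPi_le hK x).trans ?_
      by_cases hxQ : x ∈ Q
      · have : x ∈ Set.univ.pi fun _ : Fin p => A := hxQ
        rw [Set.indicator_of_mem this]
        simp [hxU, hxQ, hη.le]
      · have : x ∉ Set.univ.pi fun _ : Fin p => A := hxQ
        rw [Set.indicator_of_notMem this]
        simp [hxQ]
  · simp only [Pi.add_apply, Pi.smul_apply, smul_eq_mul]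
    rw [integral_add (hQint.const_mul _) (hdint.const_mul _), integral_const_mul,
      integral_const_mul, integral_indicator_const _ hQ, integral_indicator_const _ (hQ.diff (hUm N))]
    simp only [smul_eq_mul, mul_one]
    refine le_trans ?_ hηle
    have : m.real (Q \ U N) ≤ η := by
      rw [measureReal_def]
      exact ENNReal.toReal_le_of_le_ofReal hη.le hN.le
    gcongr

end Approximation

/-! ### Renormalized return integrals of bounded almost everywhere continuous functions. -/

section Return

variable {E : Type*} [MeasurableSpace E] {μ : Measure E} {A : Set E} [TopologicalSpace A] {p : ℕ}

theorem memLp_extendZeroPi [SigmaFinite μ] [PolishSpace A] [BorelSpace A]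
    (hA : MeasurableSet A) (hA_fin : μ A < ∞) (hne : A.Nonempty) {f : (Fin p → A) → ℝ} {K : ℝ}
    (hK : ∀ y, |f y| ≤ K)
    (hf : ∀ᵐ y ∂(Measure.pi fun _ : Fin p => μ.comap (Subtype.val : A → E)), ContinuousAt f y)
    (q : ℝ≥0∞) : MemLp (extendZeroPi f) q (Measure.pi fun _ : Fin p => μ) := by
  have hQ : MeasurableSet (Set.univ.pi fun _ : Fin p => A) := MeasurableSet.univ_pi fun _ => hA
  have hQfin : (Measure.pi fun _ : Fin p => μ) (Set.univ.pi fun _ => A) ≠ ∞ := by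
    rw [Measure.pi_pi]
    exact (ENNReal.prod_lt_top fun _ _ => hA_fin).ne
  refine (memLp_indicator_const q hQ K (Or.inr hQfin)).mono
    (aestronglyMeasurable_extendZeroPi hA hA_fin hne hf) (Eventually.of_forall fun x => ?_)
  rw [Real.norm_eq_abs, Real.norm_eq_abs]
  exact (abs_extendZeroPi_le hK x).trans (le_abs_self _)

theorem memLp_extendZeroPi_comp_prodIter [SigmaFinite μ] [PolishSpace A] [BorelSpace A]
    {T : E → E} (hT : MeasurePreserving T μ μ)
    (hA : MeasurableSet A) (hA_fin : μ A < ∞) (hne : A.Nonempty) {f : (Fin p → A) → ℝ} {K : ℝ}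
    (hK : ∀ y, |f y| ≤ K)
    (hf : ∀ᵐ y ∂(Measure.pi fun _ : Fin p => μ.comap (Subtype.val : A → E)), ContinuousAt f y)
    (q : ℝ≥0∞) (k : ℕ) :
    MemLp (extendZeroPi f ∘ prodIter T p k) q (Measure.pi fun _ : Fin p => μ) :=
  (memLp_extendZeroPi hA hA_fin hne hK hf q).comp_measurePreserving
    (measurePreserving_prodIter hT k)

/-- The bound involves only the majorants. With all of them in the continuity span, each term
integrates to a return integral of known limit. -/
theorem abs_mul_sub_mul_le {F F' l l' u u' v v' : ℝ} (hF' : |F'| ≤ v') (hF : |F| ≤ v)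
    (h : |F - l| ≤ u) (h' : |F' - l'| ≤ u') :
    |F' * F - l' * l| ≤ v' * u + u' * v + u' * u := by
  have he : F' * F - l' * l = F' * (F - l) + (F' - l') * F - (F' - l') * (F - l) := by ring
  have hv' := (abs_nonneg _).trans hF'
  have hu' := (abs_nonneg _).trans h'
  rw [he]
  calc |F' * (F - l) + (F' - l') * F - (F' - l') * (F - l)|
      ≤ |F' * (F - l)| + |(F' - l') * F| + |(F' - l') * (F - l)| :=
        (abs_sub _ _).trans (add_le_add (abs_add_le _ _) le_rfl)
    _ = |F'| * |F - l| + |F' - l'| * |F| + |F' - l'| * |F - l| := by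
        rw [abs_mul, abs_mul, abs_mul]
    _ ≤ v' * u + u' * v + u' * u := by gcongr

theorem tendsto_return_extendZeroPi [SigmaFinite μ] [PolishSpace A] [BorelSpace A]
    {T : E → E} (hT : MeasurePreserving T μ μ)
    (hA : MeasurableSet A) (hA_fin : μ A < ∞) (hne : A.Nonempty) {b : ℕ → ℝ}
    (hb : ∀ᶠ n in atTop, 0 < b n) (hret : UniformReturn μ T A b) {f : (Fin p → A) → ℝ} {K : ℝ}
    (hK : ∀ y, |f y| ≤ K)
    (hf : ∀ᵐ y ∂(Measure.pi fun _ : Fin p => μ.comap (Subtype.val : A → E)), ContinuousAt f y) :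
    Tendsto (fun n => b n ^ p * ∫ x, extendZeroPi f (prodIter T p n x) * extendZeroPi f x
        ∂(Measure.pi fun _ : Fin p => μ)) atTop
      (𝓝 ((∫ x, extendZeroPi f x ∂(Measure.pi fun _ : Fin p => μ)) ^ 2)) := by
  set m : Measure (Fin p → E) := Measure.pi fun _ : Fin p => μ with hm
  set F := extendZeroPi f with hF
  set v : (Fin p → E) → ℝ := K • (Set.univ.pi fun _ => A).indicator fun _ => (1 : ℝ) with hv
  have hvmem : v ∈ continuitySpan μ A p :=
    Submodule.smul_mem _ _ (indicator_pi_mem_continuitySpan fun _ => isContinuitySet_self hA)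
  have hFv : ∀ x, |F x| ≤ v x := by
    intro x
    refine (abs_extendZeroPi_le hK x).trans (le_of_eq ?_)
    by_cases hx : x ∈ Set.univ.pi fun _ => A
    · rw [hv, Pi.smul_apply, Set.indicator_of_mem hx, Set.indicator_of_mem hx, smul_eq_mul,
        mul_one]
    · rw [hv, Pi.smul_apply, Set.indicator_of_notMem hx, Set.indicator_of_notMem hx, smul_zero]
  have hF2 := memLp_extendZeroPi hA hA_fin hne hK hf 2
  have hF1 : Integrable F m := memLp_one_iff_integrable.1 (memLp_extendZeroPi hA hA_fin hne hK hf 1)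
  have hFF : ∀ n, Integrable (fun x => F (prodIter T p n x) * F x) m := fun n =>
    (memLp_extendZeroPi_comp_prodIter hT hA hA_fin hne hK hf 2 n).integrable_mul hF2
  rw [Metric.tendsto_nhds]
  intro ε hε
  -- The first three terms bound the limits of the error integrals; the last bounds the change from
  -- (∫ F)² to (∫ l)².
  obtain ⟨δ, hδ, hδε⟩ : ∃ δ : ℝ, 0 < δ ∧
      (∫ x, v x ∂m) * δ + δ * (∫ x, v x ∂m) + δ * δ + δ * (2 * |∫ x, F x ∂m| + δ) < ε := by
    have hcont : Tendsto (fun δ : ℝ => (∫ x, v x ∂m) * δ + δ * (∫ x, v x ∂m) + δ * δ +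
        δ * (2 * |∫ x, F x ∂m| + δ)) (𝓝[>] 0) (𝓝 0) := by
      have : Continuous fun δ : ℝ => (∫ x, v x ∂m) * δ + δ * (∫ x, v x ∂m) + δ * δ +
        δ * (2 * |∫ x, F x ∂m| + δ) := by fun_prop
      have h := this.tendsto 0
      simp only [mul_zero, zero_mul, add_zero] at h
      exact h.mono_left nhdsWithin_le_nhds
    obtain ⟨δ, h1, h2⟩ := ((hcont.eventually (gt_mem_nhds hε)).and self_mem_nhdsWithin).exists
    exact ⟨δ, h2, h1⟩
  obtain ⟨l, hl, u, hu, hlu, huδ⟩ := exists_continuitySpan_approx hA hA_fin hne hK hf hδ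
  have hlint := integrable_of_mem_continuitySpan hA_fin hl
  have huint := integrable_of_mem_continuitySpan hA_fin hu
  have hu0 : ∀ x, 0 ≤ u x := fun x => (abs_nonneg _).trans (hlu x)
  have hv0 : ∀ x, 0 ≤ v x := fun x => (abs_nonneg _).trans (hFv x)
  have hU0 : 0 ≤ ∫ x, u x ∂m := integral_nonneg hu0
  have hV0 : 0 ≤ ∫ x, v x ∂m := integral_nonneg hv0
  have hFl : |(∫ x, F x ∂m) - ∫ x, l x ∂m| ≤ δ := by
    rw [← integral_sub hF1 hlint]
    refine (abs_integral_le_integral_abs).trans (le_trans ?_ huδ)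
    exact integral_mono_of_nonneg (Eventually.of_forall fun _ => abs_nonneg _) huint
      (Eventually.of_forall hlu)
  obtain ⟨i1, t1⟩ := tendsto_return_continuitySpan hT hA hA_fin hret hvmem hu
  obtain ⟨i2, t2⟩ := tendsto_return_continuitySpan hT hA hA_fin hret hu hvmem
  obtain ⟨i3, t3⟩ := tendsto_return_continuitySpan hT hA hA_fin hret hu hu
  obtain ⟨i4, t4⟩ := tendsto_return_continuitySpan hT hA hA_fin hret hl hl
  have hlim := ((t1.add t2).add t3).add ((t4.sub_const ((∫ x, F x ∂m) ^ 2)).abs)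
  have hsq : |(∫ x, l x ∂m) * (∫ x, l x ∂m) - (∫ x, F x ∂m) ^ 2| ≤
      δ * (2 * |∫ x, F x ∂m| + δ) := by
    have he : (∫ x, l x ∂m) * (∫ x, l x ∂m) - (∫ x, F x ∂m) ^ 2 =
        -(((∫ x, F x ∂m) - ∫ x, l x ∂m) *
          (2 * (∫ x, F x ∂m) - ((∫ x, F x ∂m) - ∫ x, l x ∂m))) := by ring
    rw [he, abs_neg, abs_mul]
    refine mul_le_mul hFl ((abs_sub _ _).trans ?_) (abs_nonneg _) hδ.le
    rw [abs_mul, abs_two]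
    exact add_le_add le_rfl hFl
  have hlt : (∫ x, v x ∂m) * (∫ x, u x ∂m) + (∫ x, u x ∂m) * (∫ x, v x ∂m) +
      (∫ x, u x ∂m) * (∫ x, u x ∂m) +
      |(∫ x, l x ∂m) * (∫ x, l x ∂m) - (∫ x, F x ∂m) ^ 2| < ε := by
    refine lt_of_le_of_lt ?_ hδε
    gcongr
  filter_upwards [hlim.eventually (gt_mem_nhds hlt), hb] with n hn hbn
  refine lt_of_le_of_lt ?_ hn
  have hbn' : 0 ≤ b n ^ p := (pow_pos hbn p).le
  have hdiff : |(∫ x, F (prodIter T p n x) * F x ∂m) - ∫ x, l (prodIter T p n x) * l x ∂m| ≤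
      (∫ x, v (prodIter T p n x) * u x ∂m) + (∫ x, u (prodIter T p n x) * v x ∂m) +
        ∫ x, u (prodIter T p n x) * u x ∂m := by
    have i12 : Integrable (fun x => v (prodIter T p n x) * u x + u (prodIter T p n x) * v x) m :=
      (i1 n).add (i2 n)
    rw [← integral_sub (hFF n) (i4 n), ← integral_add (i1 n) (i2 n), ← integral_add i12 (i3 n)]
    refine abs_integral_le_integral_abs.trans ?_
    refine integral_mono_of_nonneg (Eventually.of_forall fun _ => abs_nonneg _)
      (i12.add (i3 n)) (Eventually.of_forall fun x => ?_)
    exact abs_mul_sub_mul_le (hFv _) (hFv _) (hlu _) (hlu _)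
  rw [Real.dist_eq]
  calc |b n ^ p * (∫ x, F (prodIter T p n x) * F x ∂m) - (∫ x, F x ∂m) ^ 2|
      = |b n ^ p * ((∫ x, F (prodIter T p n x) * F x ∂m) -
          ∫ x, l (prodIter T p n x) * l x ∂m) +
          (b n ^ p * (∫ x, l (prodIter T p n x) * l x ∂m) - (∫ x, F x ∂m) ^ 2)| := by
        congr 1; ring
    _ ≤ b n ^ p * |(∫ x, F (prodIter T p n x) * F x ∂m) -
          ∫ x, l (prodIter T p n x) * l x ∂m| +
          |b n ^ p * (∫ x, l (prodIter T p n x) * l x ∂m) - (∫ x, F x ∂m) ^ 2| := by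
        refine (abs_add_le _ _).trans ?_
        rw [abs_mul, abs_of_nonneg hbn']
    _ ≤ b n ^ p * ((∫ x, v (prodIter T p n x) * u x ∂m) +
          (∫ x, u (prodIter T p n x) * v x ∂m) + ∫ x, u (prodIter T p n x) * u x ∂m) +
          |b n ^ p * (∫ x, l (prodIter T p n x) * l x ∂m) - (∫ x, F x ∂m) ^ 2| := by
        gcongr
    _ = _ := by ring

end Return

/-! ### Stability of regular variation. -/

section RegularVariation

theorem tendsto_floor_const_mul_atTop {c : ℝ} (hc : 0 < c) :
    Tendsto (fun n : ℕ => ⌊c * (n : ℝ)⌋₊) atTop atTop :=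
  tendsto_nat_floor_atTop.comp (tendsto_natCast_atTop_atTop.const_mul_atTop hc)

theorem RegularlyVarying.const_mul_inv_pow {b : ℕ → ℝ} {a c : ℝ} (hb : RegularlyVarying b a)
    (hc : 0 < c) (p : ℕ) : RegularlyVarying (fun k => c * (b k ^ p)⁻¹) ((p : ℝ) * (-a)) := by
  refine ⟨?_, fun t ht => ?_⟩
  · filter_upwards [hb.1] with n hn
    positivity
  · have h1 := ((hb.2 t ht).pow p).inv₀ (by positivity)
    have h2 : ((t ^ a) ^ p)⁻¹ = t ^ ((p : ℝ) * (-a)) := by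
      rw [← Real.rpow_natCast, ← Real.rpow_mul ht.le, ← Real.rpow_neg ht.le]
      congr 1
      ring
    rw [h2] at h1
    refine h1.congr' ?_
    filter_upwards [hb.1] with n hn
    rw [mul_div_mul_left _ _ hc.ne', div_pow, inv_div, inv_div_inv]

/-- With m = ⌊cn⌋, write u_m / u_n = (u_m / v_m) (v_m / v_n) (v_n / u_n); the outer factors tend to
1. -/
theorem RegularlyVarying.of_tendsto_div_one {u v : ℕ → ℝ} {a : ℝ} (hv : RegularlyVarying v a)
    (huv : Tendsto (fun n => u n / v n) atTop (𝓝 1)) : RegularlyVarying u a := by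
  have hpos : ∀ᶠ n in atTop, 0 < u n := by
    filter_upwards [hv.1, huv.eventually (lt_mem_nhds one_pos)] with n h1 h2
    exact (div_pos_iff_of_pos_right h1).1 h2
  refine ⟨hpos, fun c hc => ?_⟩
  have hfl := tendsto_floor_const_mul_atTop hc
  have h := ((huv.comp hfl).mul (hv.2 c hc)).mul (huv.inv₀ one_ne_zero)
  rw [one_mul, inv_one, mul_one] at h
  refine h.congr' ?_
  filter_upwards [hv.1, hpos, hfl.eventually hv.1] with n h1 h2 h3
  simp only [Function.comp_apply]
  field_simp

end RegularVariation

/-! ### Mean and variance read off the characteristic function. -/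

section Moments

/-- By the half-angle formula the expression is y²/2 times the square of a sinc whose argument tends
to 0. -/
theorem tendsto_sq_mul_one_sub_cos (y : ℝ) :
    Tendsto (fun n : ℕ => ((n : ℝ) + 1) ^ 2 * (1 - Real.cos (((n : ℝ) + 1)⁻¹ * y))) atTop
      (𝓝 (y ^ 2 / 2)) := by
  have hu : Tendsto (fun n : ℕ => ((n : ℝ) + 1)⁻¹ * (y / 2)) atTop (𝓝 0) := by
    have := (tendsto_one_div_add_atTop_nhds_zero_nat (𝕜 := ℝ)).mul_const (y / 2)
    simpa using this
  have h1 : Tendsto (fun n : ℕ => Real.sinc (((n : ℝ) + 1)⁻¹ * (y / 2))) atTop (𝓝 1) := by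
    have := (Real.continuous_sinc.tendsto 0).comp hu
    rwa [Real.sinc_zero] at this
  have h2 := (h1.pow 2).const_mul (y ^ 2 / 2)
  rw [one_pow, mul_one] at h2
  refine h2.congr fun n => ?_
  have hn : ((n : ℝ) + 1) ≠ 0 := by positivity
  by_cases hy : y = 0
  · simp [hy]
  have hc : Real.cos (((n : ℝ) + 1)⁻¹ * y) = 1 - 2 * Real.sin (((n : ℝ) + 1)⁻¹ * (y / 2)) ^ 2 := by
    have := Real.cos_two_mul' (((n : ℝ) + 1)⁻¹ * (y / 2))
    rw [Real.cos_sq', show 2 * (((n : ℝ) + 1)⁻¹ * (y / 2)) = ((n : ℝ) + 1)⁻¹ * y by ring] at this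
    rw [this]; ring
  rw [hc, Real.sinc_of_ne_zero (by positivity)]
  field_simp
  ring

theorem tendsto_mul_sin (y : ℝ) :
    Tendsto (fun n : ℕ => ((n : ℝ) + 1) * Real.sin (((n : ℝ) + 1)⁻¹ * y)) atTop (𝓝 y) := by
  have hu : Tendsto (fun n : ℕ => ((n : ℝ) + 1)⁻¹ * y) atTop (𝓝 0) := by
    have := (tendsto_one_div_add_atTop_nhds_zero_nat (𝕜 := ℝ)).mul_const y
    simpa using this
  have h1 : Tendsto (fun n : ℕ => Real.sinc (((n : ℝ) + 1)⁻¹ * y)) atTop (𝓝 1) := by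
    have := (Real.continuous_sinc.tendsto 0).comp hu
    rwa [Real.sinc_zero] at this
  have h2 := h1.const_mul y
  rw [mul_one] at h2
  refine h2.congr fun n => ?_
  have hn : ((n : ℝ) + 1) ≠ 0 := by positivity
  by_cases hy : y = 0
  · simp [hy]
  rw [Real.sinc_of_ne_zero (by positivity)]
  field_simp

theorem sq_mul_one_sub_cos_nonneg (y : ℝ) (n : ℕ) :
    0 ≤ ((n : ℝ) + 1) ^ 2 * (1 - Real.cos (((n : ℝ) + 1)⁻¹ * y)) :=
  mul_nonneg (sq_nonneg _) (sub_nonneg.2 (Real.cos_le_one _))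

theorem sq_mul_one_sub_cos_le (y : ℝ) (n : ℕ) :
    ((n : ℝ) + 1) ^ 2 * (1 - Real.cos (((n : ℝ) + 1)⁻¹ * y)) ≤ y ^ 2 / 2 := by
  have hn : (0 : ℝ) < (n : ℝ) + 1 := by positivity
  have h := Real.one_sub_sq_div_two_le_cos (x := ((n : ℝ) + 1)⁻¹ * y)
  calc ((n : ℝ) + 1) ^ 2 * (1 - Real.cos (((n : ℝ) + 1)⁻¹ * y))
      ≤ ((n : ℝ) + 1) ^ 2 * ((((n : ℝ) + 1)⁻¹ * y) ^ 2 / 2) := by gcongr; linarith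
    _ = y ^ 2 / 2 := by field_simp

theorem tendsto_integral_one_sub_cos {X : Type*} [MeasurableSpace X] {ν : Measure X} {Y : X → ℝ}
    (hY : Measurable Y) (hint : Integrable (fun x => Y x ^ 2) ν) :
    Tendsto (fun n : ℕ => ((n : ℝ) + 1) ^ 2 *
      ∫ x, (1 - Real.cos (((n : ℝ) + 1)⁻¹ * Y x)) ∂ν) atTop (𝓝 ((∫ x, Y x ^ 2 ∂ν) / 2)) := by
  simp only [← integral_const_mul, ← integral_div]
  refine tendsto_integral_of_dominated_convergence (fun x => Y x ^ 2 / 2) (fun n => ?_)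
    (hint.div_const 2) (fun n => Eventually.of_forall fun x => ?_)
    (Eventually.of_forall fun x => tendsto_sq_mul_one_sub_cos _)
  · exact Measurable.aestronglyMeasurable (by fun_prop)
  · rw [Real.norm_eq_abs, abs_of_nonneg (sq_mul_one_sub_cos_nonneg _ n)]
    exact sq_mul_one_sub_cos_le _ n

/-- Squeeze by x e⁻ˣ ≤ 1 - e⁻ˣ ≤ x, where x tends to 0 because a x converges while a diverges. -/
theorem tendsto_mul_one_sub_exp_neg {a x : ℕ → ℝ} {c : ℝ} (ha : Tendsto a atTop atTop)
    (h : Tendsto (fun n => a n * x n) atTop (𝓝 c)) :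
    Tendsto (fun n => a n * (1 - Real.exp (-x n))) atTop (𝓝 c) := by
  have hx0 : Tendsto x atTop (𝓝 0) := by
    have h0 := h.mul (tendsto_inv_atTop_zero.comp ha)
    rw [mul_zero] at h0
    refine h0.congr' ?_
    filter_upwards [ha.eventually_gt_atTop 0] with n hn
    simp only [Function.comp_apply]
    field_simp
  have hlow : Tendsto (fun n => a n * x n * Real.exp (-x n)) atTop (𝓝 c) := by
    have := h.mul ((Real.continuous_exp.tendsto _).comp hx0.neg)
    simpa using this
  refine tendsto_of_tendsto_of_tendsto_of_le_of_le' hlow h ?_ ?_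
  · filter_upwards [ha.eventually_ge_atTop 0] with n hn
    rw [mul_assoc]
    refine mul_le_mul_of_nonneg_left ?_ hn
    have h1 := Real.add_one_le_exp (x n)
    have h2 : Real.exp (x n) * Real.exp (-x n) = 1 := by rw [← Real.exp_add]; simp
    nlinarith [Real.exp_pos (-x n)]
  · filter_upwards [ha.eventually_ge_atTop 0] with n hn
    refine mul_le_mul_of_nonneg_left ?_ hn
    linarith [Real.add_one_le_exp (-x n)]

theorem IsSymmUnitLevy.integrable_sq {ρ : Measure ℝ} (hρ : IsSymmUnitLevy ρ) :
    Integrable (fun y : ℝ => y ^ 2) ρ := by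
  refine ⟨by fun_prop, ?_⟩
  rw [hasFiniteIntegral_iff_ofReal (Eventually.of_forall fun y => sq_nonneg y), hρ.second_moment]
  exact ENNReal.one_lt_top

theorem IsSymmUnitLevy.integral_sq {ρ : Measure ℝ} (hρ : IsSymmUnitLevy ρ) :
    ∫ y, y ^ 2 ∂ρ = 1 := by
  rw [integral_eq_lintegral_of_nonneg_ae (Eventually.of_forall fun y => sq_nonneg y)
    (by fun_prop), hρ.second_moment, ENNReal.toReal_one]

theorem integrable_exp_mul_I {Ω : Type*} [MeasurableSpace Ω] {P : Measure Ω}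
    [IsProbabilityMeasure P] {Y : Ω → ℝ} (hY : Measurable Y) :
    Integrable (fun ω => Complex.exp (Complex.I * ((Y ω : ℝ) : ℂ))) P := by
  refine Integrable.of_bound (C := 1) (Measurable.aestronglyMeasurable (by fun_prop))
    (Eventually.of_forall fun ω => ?_)
  rw [mul_comm, Complex.norm_exp_ofReal_mul_I]

/-- A random variable with the characteristic function of a compensated compound Poisson law of
intensity `c` is centered with variance `c`. -/
theorem moments_of_charFun {Ω : Type*} [MeasurableSpace Ω] {P : Measure Ω}
    [IsProbabilityMeasure P] {ρ : Measure ℝ} (hρ : IsSymmUnitLevy ρ) {Y : Ω → ℝ}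
    (hY : Measurable Y) {c : ℝ}
    (hchar : ∀ u : ℝ, ∫ ω, Complex.exp (Complex.I * ((u * Y ω : ℝ) : ℂ)) ∂P =
      ((Real.exp (-(c * ∫ y, (1 - Real.cos (u * y)) ∂ρ)) : ℝ) : ℂ)) :
    MemLp Y 2 P ∧ ∫ ω, Y ω ∂P = 0 ∧ ∫ ω, Y ω ^ 2 ∂P = c := by
  have hcos : ∀ u : ℝ, ∫ ω, Real.cos (u * Y ω) ∂P =
      Real.exp (-(c * ∫ y, (1 - Real.cos (u * y)) ∂ρ)) := by
    intro u
    have h := integral_re (𝕜 := ℂ) (integrable_exp_mul_I (P := P) (hY.const_mul u))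
    rw [hchar u] at h
    refine Eq.trans (integral_congr_ae (Eventually.of_forall fun ω => ?_)) h
    change _ = (Complex.exp (Complex.I * ((u * Y ω : ℝ) : ℂ))).re
    rw [mul_comm Complex.I, Complex.exp_ofReal_mul_I_re]
  have hsin : ∀ u : ℝ, ∫ ω, Real.sin (u * Y ω) ∂P = 0 := by
    intro u
    have h := integral_im (𝕜 := ℂ) (integrable_exp_mul_I (P := P) (hY.const_mul u))
    rw [hchar u] at h
    refine Eq.trans (integral_congr_ae (Eventually.of_forall fun ω => ?_))
      (h.trans (Complex.ofReal_im (Real.exp (-(c * ∫ y, (1 - Real.cos (u * y)) ∂ρ)))))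
    change _ = (Complex.exp (Complex.I * ((u * Y ω : ℝ) : ℂ))).im
    rw [mul_comm Complex.I, Complex.exp_ofReal_mul_I_im]
  have hcosint : ∀ u : ℝ, Integrable (fun ω => Real.cos (u * Y ω)) P := fun u =>
    Integrable.of_bound (C := 1) (Measurable.aestronglyMeasurable (by fun_prop))
      (Eventually.of_forall fun ω => Real.abs_cos_le_one _)
  have h1cos : ∀ u : ℝ, ∫ ω, (1 - Real.cos (u * Y ω)) ∂P =
      1 - Real.exp (-(c * ∫ y, (1 - Real.cos (u * y)) ∂ρ)) := by
    intro u
    rw [integral_sub (integrable_const _) (hcosint u), hcos]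
    simp
  have hρlim := (tendsto_integral_one_sub_cos measurable_id hρ.integrable_sq).const_mul c
  simp only [id_eq] at hρlim
  rw [hρ.integral_sq] at hρlim
  have hsqtop : Tendsto (fun n : ℕ => ((n : ℝ) + 1) ^ 2) atTop atTop := by
    refine (tendsto_pow_atTop two_ne_zero).comp ?_
    exact tendsto_atTop_add_const_right _ _ tendsto_natCast_atTop_atTop
  have hlim : Tendsto (fun n : ℕ => ((n : ℝ) + 1) ^ 2 *
      ∫ ω, (1 - Real.cos (((n : ℝ) + 1)⁻¹ * Y ω)) ∂P) atTop (𝓝 (c * (1 / 2))) := by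
    simp only [h1cos]
    refine tendsto_mul_one_sub_exp_neg hsqtop ?_
    simpa only [mul_left_comm c] using hρlim
  -- Square integrability of `Y` is not known beforehand. Fatou's lemma extracts it from the
  -- convergence of the second difference quotients of the characteristic function at 0.
  have hfin : ∫⁻ ω, ENNReal.ofReal (Y ω ^ 2 / 2) ∂P < ∞ := by
    have hF : ∀ ω, ENNReal.ofReal (Y ω ^ 2 / 2) = liminf (fun n : ℕ => ENNReal.ofReal
        (((n : ℝ) + 1) ^ 2 * (1 - Real.cos (((n : ℝ) + 1)⁻¹ * Y ω)))) atTop := fun ω =>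
      (ENNReal.tendsto_ofReal (tendsto_sq_mul_one_sub_cos (Y ω))).liminf_eq.symm
    simp only [hF]
    refine (lintegral_liminf_le fun n => by fun_prop).trans_lt ?_
    have hI : ∀ n : ℕ, ∫⁻ ω, ENNReal.ofReal
        (((n : ℝ) + 1) ^ 2 * (1 - Real.cos (((n : ℝ) + 1)⁻¹ * Y ω))) ∂P = ENNReal.ofReal
        (((n : ℝ) + 1) ^ 2 * ∫ ω, (1 - Real.cos (((n : ℝ) + 1)⁻¹ * Y ω)) ∂P) := by
      intro n
      have hi : Integrable (fun ω => ((n : ℝ) + 1) ^ 2 *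
          (1 - Real.cos (((n : ℝ) + 1)⁻¹ * Y ω))) P :=
        ((integrable_const _).sub (hcosint _)).const_mul _
      rw [← integral_const_mul, ofReal_integral_eq_lintegral_ofReal hi
        (Eventually.of_forall fun ω => sq_mul_one_sub_cos_nonneg _ n)]
    simp only [hI]
    rw [(ENNReal.tendsto_ofReal hlim).liminf_eq]
    exact ENNReal.ofReal_lt_top
  have hint : Integrable (fun ω => Y ω ^ 2) P := by
    have h2 : Integrable (fun ω => Y ω ^ 2 / 2) P := by
      refine ⟨by fun_prop, ?_⟩
      rwa [hasFiniteIntegral_iff_ofReal (Eventually.of_forall fun ω => by positivity)]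
    refine (h2.const_mul 2).congr (Eventually.of_forall fun ω => ?_)
    ring
  have hmem : MemLp Y 2 P := (memLp_two_iff_integrable_sq hY.aestronglyMeasurable).2 hint
  refine ⟨hmem, ?_, ?_⟩
  -- The characteristic function is real, so E sin(uY) = 0 for every u; scaling and letting u → 0
  -- gives the mean.
  · have hY1 : Integrable Y P := hmem.integrable one_le_two
    have h := tendsto_integral_of_dominated_convergence (μ := P)
      (F := fun (n : ℕ) ω => ((n : ℝ) + 1) * Real.sin (((n : ℝ) + 1)⁻¹ * Y ω)) (f := Y)
      (fun ω => |Y ω|) (fun n => Measurable.aestronglyMeasurable (by fun_prop)) hY1.abs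
      (fun n => Eventually.of_forall fun ω => ?_)
      (Eventually.of_forall fun ω => tendsto_mul_sin (Y ω))
    · simp only [integral_const_mul, hsin, mul_zero] at h
      exact tendsto_nhds_unique h tendsto_const_nhds
    · have hn : (0 : ℝ) < (n : ℝ) + 1 := by positivity
      rw [Real.norm_eq_abs, abs_mul, abs_of_pos hn]
      calc ((n : ℝ) + 1) * |Real.sin (((n : ℝ) + 1)⁻¹ * Y ω)|
          ≤ ((n : ℝ) + 1) * |((n : ℝ) + 1)⁻¹ * Y ω| :=
            mul_le_mul_of_nonneg_left Real.abs_sin_le_abs hn.le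
        _ = |Y ω| := by rw [abs_mul, abs_of_pos (inv_pos.2 hn)]; field_simp
  · have h := tendsto_nhds_unique (tendsto_integral_one_sub_cos hY hint) hlim
    linarith

end Moments

/-! ### Finite families of values of the random measure. -/

section RandomMeasure

variable {E Ω : Type*} [MeasurableSpace E] [MeasurableSpace Ω] {μ : Measure E} {ρ : Measure ℝ}
  {P : Measure Ω} {M : Set E → Ω → ℝ} {ι : Type*}

/-- Independence and additivity of `M` are postulated for sequences; padding with empty sets makes
them available for finite families. -/
theorem exists_nat_extension [Finite ι] {B : ι → Set E} (hB : ∀ i, MeasurableSet (B i))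
    (hfin : ∀ i, μ (B i) < ∞) (hd : Pairwise fun i j => Disjoint (B i) (B j)) :
    ∃ (e : ι → ℕ) (C : ℕ → Set E), Function.Injective e ∧ (∀ i, C (e i) = B i) ∧
      (∀ n, n ∉ Set.range e → C n = ∅) ∧ (∀ n, MeasurableSet (C n)) ∧ (∀ n, μ (C n) < ∞) ∧
      Pairwise fun m n => Disjoint (C m) (C n) := by
  classical
  obtain ⟨N, ⟨e⟩⟩ := Finite.exists_equiv_fin ι
  have hinj : Function.Injective fun i => (e i : ℕ) := Fin.val_injective.comp e.injective
  set C : ℕ → Set E := Function.extend (fun i => (e i : ℕ)) B fun _ => ∅ with hC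
  have h1 : ∀ i, C (e i) = B i := fun i => hinj.extend_apply _ _ _
  have h2 : ∀ n, n ∉ Set.range (fun i => (e i : ℕ)) → C n = ∅ := fun n hn =>
    Function.extend_apply' _ _ _ hn
  refine ⟨fun i => e i, C, hinj, h1, h2, fun n => ?_, fun n => ?_, fun m n hmn => ?_⟩
  · by_cases hn : n ∈ Set.range fun i => (e i : ℕ)
    · obtain ⟨i, rfl⟩ := hn
      exact (h1 i).symm ▸ hB i
    · exact (h2 n hn).symm ▸ MeasurableSet.empty
  · by_cases hn : n ∈ Set.range fun i => (e i : ℕ)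
    · obtain ⟨i, rfl⟩ := hn
      exact (h1 i).symm ▸ hfin i
    · rw [h2 n hn, measure_empty]
      exact ENNReal.zero_lt_top
  · by_cases hn : n ∈ Set.range fun i => (e i : ℕ)
    · by_cases hm : m ∈ Set.range fun i => (e i : ℕ)
      · obtain ⟨i, rfl⟩ := hn
        obtain ⟨j, rfl⟩ := hm
        simp only [h1]
        exact hd fun hij => hmn (by rw [hij])
      · simp only [h2 m hm, Set.empty_disjoint]
    · simp only [h2 n hn, Set.disjoint_empty]

theorem IsIDRandomMeasure.iIndepFun_of_finite [Finite ι] (hM : IsIDRandomMeasure μ ρ P M)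
    {B : ι → Set E} (hB : ∀ i, MeasurableSet (B i)) (hfin : ∀ i, μ (B i) < ∞)
    (hd : Pairwise fun i j => Disjoint (B i) (B j)) : iIndepFun (fun i => M (B i)) P := by
  obtain ⟨e, C, he, h1, -, hCm, hCf, hCd⟩ := exists_nat_extension hB hfin hd
  have h := (hM.independent C hCm hCf hCd).precomp he
  simpa only [h1] using h

variable [IsProbabilityMeasure P]

theorem IsIDRandomMeasure.memLp (hM : IsIDRandomMeasure μ ρ P M) (hρ : IsSymmUnitLevy ρ)
    {B : Set E} (hB : MeasurableSet B) (hfin : μ B < ∞) : MemLp (M B) 2 P :=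
  (moments_of_charFun hρ (hM.measurable B hB hfin)
    (hM.char_fun B hB hfin)).1

theorem IsIDRandomMeasure.integral_eq_zero (hM : IsIDRandomMeasure μ ρ P M)
    (hρ : IsSymmUnitLevy ρ) {B : Set E} (hB : MeasurableSet B) (hfin : μ B < ∞) :
    ∫ ω, M B ω ∂P = 0 :=
  (moments_of_charFun hρ (hM.measurable B hB hfin)
    (hM.char_fun B hB hfin)).2.1

theorem IsIDRandomMeasure.integral_sq (hM : IsIDRandomMeasure μ ρ P M)
    (hρ : IsSymmUnitLevy ρ) {B : Set E} (hB : MeasurableSet B) (hfin : μ B < ∞) :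
    ∫ ω, M B ω ^ 2 ∂P = μ.real B :=
  (moments_of_charFun hρ (hM.measurable B hB hfin)
    (hM.char_fun B hB hfin)).2.2

/-- The variance vanishes. For the empty set this removes the padding terms in finite additivity. -/
theorem IsIDRandomMeasure.ae_eq_zero_of_null (hM : IsIDRandomMeasure μ ρ P M)
    (hρ : IsSymmUnitLevy ρ) {B : Set E} (hB : MeasurableSet B) (h0 : μ B = 0) :
    M B =ᵐ[P] 0 := by
  have hfin : μ B < ∞ := h0 ▸ ENNReal.zero_lt_top
  have h := hM.integral_sq hρ hB hfin
  rw [measureReal_def, h0, ENNReal.toReal_zero,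
    integral_eq_zero_iff_of_nonneg (fun ω => sq_nonneg _) (hM.memLp hρ hB hfin).integrable_sq] at h
  filter_upwards [h] with ω hω
  simpa using hω

theorem IsIDRandomMeasure.ae_eq_sum [Fintype ι] (hM : IsIDRandomMeasure μ ρ P M)
    (hρ : IsSymmUnitLevy ρ) {B : ι → Set E} (hB : ∀ i, MeasurableSet (B i))
    (hfin : ∀ i, μ (B i) < ∞) (hd : Pairwise fun i j => Disjoint (B i) (B j)) :
    M (⋃ i, B i) =ᵐ[P] fun ω => ∑ i, M (B i) ω := by
  classical
  obtain ⟨e, C, he, h1, h2, hCm, hCf, hCd⟩ := exists_nat_extension hB hfin hd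
  have hU : ⋃ n, C n = ⋃ i, B i := by
    ext x
    simp only [Set.mem_iUnion]
    constructor
    · rintro ⟨n, hn⟩
      by_cases hr : n ∈ Set.range e
      · obtain ⟨i, rfl⟩ := hr
        exact ⟨i, h1 i ▸ hn⟩
      · rw [h2 n hr] at hn
        exact hn.elim
    · rintro ⟨i, hi⟩
      exact ⟨e i, (h1 i).symm ▸ hi⟩
  have hUfin : μ (⋃ n, C n) < ∞ := by
    rw [hU]
    refine (measure_iUnion_le _).trans_lt ?_
    rw [tsum_fintype]
    exact ENNReal.sum_lt_top.2 fun i _ => hfin i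
  have h0 := hM.ae_eq_zero_of_null hρ MeasurableSet.empty measure_empty
  filter_upwards [hM.sigma_additive C hCm hCf hCd hUfin, h0] with ω hω h0ω
  rw [hU] at hω
  refine tendsto_nhds_unique hω (tendsto_const_nhds.congr' ?_)
  obtain ⟨N, hN⟩ : ∃ N, ∀ i, e i < N := by
    obtain ⟨N, hN⟩ := (Set.finite_range e).bddAbove
    exact ⟨N + 1, fun i => Nat.lt_succ_of_le (hN ⟨i, rfl⟩)⟩
  filter_upwards [eventually_ge_atTop N] with n hn
  rw [← Finset.sum_subset (s₁ := Finset.univ.image e) (f := fun k => M (C k) ω)]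
  · rw [Finset.sum_image he.injOn]
    simp only [h1]
  · intro k hk
    simp only [Finset.mem_image, Finset.mem_univ, true_and] at hk
    obtain ⟨i, rfl⟩ := hk
    exact Finset.mem_range.2 ((hN i).trans_le hn)
  · intro k _ hk
    rw [h2 k fun ⟨i, hi⟩ => hk (Finset.mem_image.2 ⟨i, Finset.mem_univ i, hi⟩)]
    exact h0ω

end RandomMeasure

/-! ### Integrability and orthogonality of products of independent variables. -/

section Independence

variable {Ω κ : Type*} [MeasurableSpace Ω] {P : Measure Ω} [IsProbabilityMeasure P] [Fintype κ]
  {ξ : κ → Ω → ℝ}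

theorem integrable_prod_comp_of_iIndepFun (hξ : iIndepFun ξ P) (hm : ∀ a, Measurable (ξ a))
    {g : κ → ℝ → ℝ} (hg : ∀ a, Measurable (g a)) (hint : ∀ a, Integrable (fun ω => g a (ξ a ω)) P) :
    Integrable (fun ω => ∏ a, g a (ξ a ω)) P := by
  have hpi : Integrable (fun x : κ → ℝ => ∏ a, g a (x a))
      (Measure.pi fun a => P.map (ξ a)) := by
    have : ∀ a, IsProbabilityMeasure (P.map (ξ a)) := fun a =>
      Measure.isProbabilityMeasure_map (hm a).aemeasurable
    refine Integrable.fintype_prod_dep fun a => ?_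
    exact (integrable_map_measure (hg a).aestronglyMeasurable (hm a).aemeasurable).2 (hint a)
  rw [← hξ.map_fun_eq_pi_map fun a => (hm a).aemeasurable] at hpi
  exact (integrable_map_measure hpi.aestronglyMeasurable
    (measurable_pi_lambda _ hm).aemeasurable).1 hpi

theorem memLp_two_prod_of_iIndepFun (hξ : iIndepFun ξ P) (hm : ∀ a, Measurable (ξ a))
    (hL : ∀ a, MemLp (ξ a) 2 P) : MemLp (fun ω => ∏ a, ξ a ω) 2 P := by
  rw [memLp_two_iff_integrable_sq (Finset.measurable_fun_prod _ fun a _ => hm a).aestronglyMeasurable]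
  simp only [← Finset.prod_pow]
  exact integrable_prod_comp_of_iIndepFun (g := fun _ x => x ^ 2) hξ hm
    (fun a => by fun_prop) fun a => (hL a).integrable_sq

variable [DecidableEq κ]

/-- Products of distinct members of a centered independent family are orthogonal. -/
theorem integral_prod_mul_prod_of_iIndepFun (hξ : iIndepFun ξ P) (hm : ∀ a, Measurable (ξ a))
    (hL : ∀ a, MemLp (ξ a) 2 P) (h0 : ∀ a, ∫ ω, ξ a ω ∂P = 0) (S S' : Finset κ) :
    Integrable (fun ω => (∏ a ∈ S, ξ a ω) * ∏ a ∈ S', ξ a ω) P ∧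
    ∫ ω, (∏ a ∈ S, ξ a ω) * ∏ a ∈ S', ξ a ω ∂P =
      if S = S' then ∏ a ∈ S, ∫ ω, ξ a ω ^ 2 ∂P else 0 := by
  -- The product of the two monomials as one product over all indices: the factor is x² on `S ∩ S'`,
  -- x on the symmetric difference and 1 elsewhere.
  let g : κ → ℝ → ℝ := fun a x => (if a ∈ S then x else 1) * (if a ∈ S' then x else 1)
  have hg : ∀ a, Measurable (g a) := by
    intro a
    by_cases h1 : a ∈ S <;> by_cases h2 : a ∈ S' <;> simp only [g, h1, h2, if_true, if_false] <;>
      fun_prop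
  have heq : ∀ ω, (∏ a ∈ S, ξ a ω) * ∏ a ∈ S', ξ a ω = ∏ a, g a (ξ a ω) := by
    intro ω
    simp only [g]
    rw [Finset.prod_mul_distrib]
    simp [Finset.prod_ite_mem]
  have hgint : ∀ a, Integrable (fun ω => g a (ξ a ω)) P := by
    intro a
    have hsq : Integrable (fun ω => ξ a ω * ξ a ω) P := (hL a).integrable_mul (hL a)
    have hone : Integrable (ξ a) P := (hL a).integrable one_le_two
    by_cases h1 : a ∈ S <;> by_cases h2 : a ∈ S' <;>
      simp only [g, h1, h2, if_true, if_false, mul_one, one_mul] <;>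
      first | assumption | exact integrable_const _
  simp only [heq]
  refine ⟨integrable_prod_comp_of_iIndepFun hξ hm hg hgint, ?_⟩
  rw [hξ.integral_fun_prod_comp (fun a => (hm a).aemeasurable)
    fun a => (hg a).aestronglyMeasurable]
  split_ifs with hS
  · subst hS
    rw [← Finset.prod_subset (Finset.subset_univ S)]
    · refine Finset.prod_congr rfl fun a ha => ?_
      simp [g, ha, sq]
    · intro a _ ha
      simp [g, ha]
  -- An index in exactly one of the two sets contributes a single centered factor.
  · obtain ⟨a, ha⟩ : ∃ a, ¬(a ∈ S ↔ a ∈ S') := by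
      by_contra hcon
      push Not at hcon
      exact hS (Finset.ext hcon)
    refine Finset.prod_eq_zero (Finset.mem_univ a) ?_
    by_cases h1 : a ∈ S <;> by_cases h2 : a ∈ S' <;> simp_all [g]

end Independence

/-! ### Common atoms of two disjoint families, and matchings. -/

section Atoms

variable {E : Type*} {p : ℕ}

/-- The atoms of the algebra generated by two finite disjoint families. -/
def jointAtom (B C : Fin p → Set E) (a : Option (Fin p) × Option (Fin p)) : Set E :=
  (a.1.elim (⋃ i, B i)ᶜ B ∩ a.2.elim (⋃ j, C j)ᶜ C) ∩ ((⋃ i, B i) ∪ ⋃ j, C j)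

theorem disjoint_elim_compl {B : Fin p → Set E} (hB : Pairwise fun i j => Disjoint (B i) (B j))
    {i j : Option (Fin p)} (hij : i ≠ j) :
    Disjoint (i.elim (⋃ i, B i)ᶜ B) (j.elim (⋃ i, B i)ᶜ B) := by
  cases i with
  | none =>
    cases j with
    | none => exact (hij rfl).elim
    | some j => exact disjoint_compl_left.mono_right (Set.subset_iUnion B j)
  | some i =>
    cases j with
    | none => exact disjoint_compl_right.mono_left (Set.subset_iUnion B i)
    | some j => exact hB fun h => hij (congrArg some h)

theorem pairwise_disjoint_jointAtom {B C : Fin p → Set E}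
    (hB : Pairwise fun i j => Disjoint (B i) (B j))
    (hC : Pairwise fun i j => Disjoint (C i) (C j)) :
    Pairwise fun a a' => Disjoint (jointAtom B C a) (jointAtom B C a') := by
  rintro ⟨i, j⟩ ⟨i', j'⟩ hne
  by_cases hi : i = i'
  · have hj : j ≠ j' := fun h => hne (by rw [hi, h])
    exact (disjoint_elim_compl hC hj).mono (Set.inter_subset_left.trans Set.inter_subset_right)
      (Set.inter_subset_left.trans Set.inter_subset_right)
  · exact (disjoint_elim_compl hB hi).mono (Set.inter_subset_left.trans Set.inter_subset_left)
      (Set.inter_subset_left.trans Set.inter_subset_left)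

theorem exists_mem_elim_compl (C : Fin p → Set E) (x : E) :
    ∃ j : Option (Fin p), x ∈ j.elim (⋃ j, C j)ᶜ C := by
  by_cases hx : x ∈ ⋃ j, C j
  · obtain ⟨j, hj⟩ := Set.mem_iUnion.1 hx
    exact ⟨some j, hj⟩
  · exact ⟨none, hx⟩

theorem iUnion_jointAtom_left (B C : Fin p → Set E) (i : Fin p) :
    ⋃ j, jointAtom B C (some i, j) = B i := by
  ext x
  simp only [Set.mem_iUnion]
  constructor
  · rintro ⟨j, hj⟩
    exact hj.1.1
  · intro hx
    obtain ⟨j, hj⟩ := exists_mem_elim_compl C x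
    exact ⟨j, ⟨hx, hj⟩, Or.inl (Set.mem_iUnion.2 ⟨i, hx⟩)⟩

theorem iUnion_jointAtom_right (B C : Fin p → Set E) (j : Fin p) :
    ⋃ i, jointAtom B C (i, some j) = C j := by
  ext x
  simp only [Set.mem_iUnion]
  constructor
  · rintro ⟨i, hi⟩
    exact hi.1.2
  · intro hx
    obtain ⟨i, hi⟩ := exists_mem_elim_compl B x
    exact ⟨i, ⟨hi, hx⟩, Or.inr (Set.mem_iUnion.2 ⟨j, hx⟩)⟩

theorem jointAtom_some_some (B C : Fin p → Set E) (i j : Fin p) :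
    jointAtom B C (some i, some j) = B i ∩ C j := by
  refine Set.inter_eq_left.2 fun x hx => Or.inl (Set.mem_iUnion.2 ⟨i, hx.1⟩)

/-- Matching of the rows and the columns of a square array by permutations. -/
theorem sum_matching_eq_sum_perm (v : Option (Fin p) × Option (Fin p) → ℝ) :
    ∑ α : Fin p → Option (Fin p), ∑ γ : Fin p → Option (Fin p),
      (if Finset.univ.image (fun i => (some i, α i)) = Finset.univ.image (fun j => (γ j, some j))
        then ∏ a ∈ Finset.univ.image (fun i => (some i, α i)), v a else 0) =
    ∑ σ : Equiv.Perm (Fin p), ∏ i, v (some i, some (σ i)) := by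
  rw [← Fintype.sum_prod_type', ← Finset.sum_filter]
  symm
  refine Finset.sum_nbij (fun σ => (fun i => some (σ i), fun j => some (σ.symm j))) ?_ ?_ ?_ ?_
  · intro σ _
    simp only [Finset.mem_filter, Finset.mem_univ, true_and]
    ext ⟨i, j⟩
    simp only [Finset.mem_image, Finset.mem_univ, true_and, Prod.mk.injEq]
    constructor
    · rintro ⟨i', rfl, rfl⟩
      exact ⟨σ i', by simp, rfl⟩
    · rintro ⟨j', rfl, rfl⟩
      exact ⟨σ.symm j', rfl, by simp⟩
  · intro σ _ τ _ h
    ext i : 1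
    exact Option.some_injective _ (congrFun (congrArg Prod.fst h) i)
  · rintro ⟨α, γ⟩ h
    simp only [Finset.coe_filter, Finset.mem_univ, true_and, Set.mem_ofPred_eq] at h
    -- If the row choices and the column choices select the same cells, no cell can involve `none`,
    -- and each row determines its column injectively.
    have hex : ∀ i, ∃ j, γ j = some i ∧ some j = α i := by
      intro i
      have hi : (some i, α i) ∈ Finset.univ.image (fun j => (γ j, some j)) := by
        rw [← h]
        exact Finset.mem_image_of_mem (fun i => (some i, α i)) (Finset.mem_univ i)
      obtain ⟨j, -, hj⟩ := Finset.mem_image.1 hi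
      exact ⟨j, congrArg Prod.fst hj, congrArg Prod.snd hj⟩
    choose s hs1 hs2 using hex
    have hinj : Function.Injective s := by
      intro i j hij
      have h1 := hs1 i
      rw [hij, hs1 j] at h1
      exact (Option.some_injective _ h1).symm
    let σ : Equiv.Perm (Fin p) := Equiv.ofBijective s (Finite.injective_iff_bijective.1 hinj)
    refine ⟨σ, by simp, Prod.ext (funext fun i => hs2 i) (funext fun j => ?_)⟩
    have h1 := hs1 (σ.symm j)
    have h2 : s (σ.symm j) = j := σ.apply_symm_apply j
    rw [h2] at h1
    exact h1.symm
  · intro σ _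
    rw [Finset.prod_image fun i _ j _ h => Option.some_injective _ (congrArg Prod.fst h)]

end Atoms

/-! ### The covariance formula for elementary integrals. -/

section Isometry

variable {E Ω : Type*} [MeasurableSpace E] [MeasurableSpace Ω] {μ : Measure E} {ρ : Measure ℝ}
  {P : Measure Ω} [IsProbabilityMeasure P] {M : Set E → Ω → ℝ} {p : ℕ}

theorem measurableSet_jointAtom {B C : Fin p → Set E} (hB : ∀ i, MeasurableSet (B i))
    (hC : ∀ i, MeasurableSet (C i)) (a : Option (Fin p) × Option (Fin p)) :
    MeasurableSet (jointAtom B C a) := by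
  have hBU := MeasurableSet.iUnion hB
  have hCU := MeasurableSet.iUnion hC
  obtain ⟨i, j⟩ := a
  refine MeasurableSet.inter (MeasurableSet.inter ?_ ?_) (hBU.union hCU)
  · cases i
    · exact hBU.compl
    · exact hB _
  · cases j
    · exact hCU.compl
    · exact hC _

theorem measure_jointAtom_lt_top {B C : Fin p → Set E} (hB : ∀ i, μ (B i) < ∞)
    (hC : ∀ i, μ (C i) < ∞) (a : Option (Fin p) × Option (Fin p)) :
    μ (jointAtom B C a) < ∞ := by
  refine (measure_mono Set.inter_subset_right).trans_lt (measure_union_lt_top ?_ ?_) <;>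
  · refine (measure_iUnion_le _).trans_lt ?_
    rw [tsum_fintype]
    exact ENNReal.sum_lt_top.2 fun i _ => by solve_by_elim

theorem IsIDRandomMeasure.memLp_prod (hM : IsIDRandomMeasure μ ρ P M) (hρ : IsSymmUnitLevy ρ)
    {B : Fin p → Set E} (hB : ∀ i, MeasurableSet (B i)) (hfin : ∀ i, μ (B i) < ∞)
    (hd : Pairwise fun i j => Disjoint (B i) (B j)) : MemLp (fun ω => ∏ i, M (B i) ω) 2 P :=
  memLp_two_prod_of_iIndepFun (hM.iIndepFun_of_finite hB hfin hd)
    (fun i => hM.measurable _ (hB i) (hfin i)) fun i => hM.memLp hρ (hB i) (hfin i)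

theorem IsIDRandomMeasure.integral_prod_mul_prod (hM : IsIDRandomMeasure μ ρ P M)
    (hρ : IsSymmUnitLevy ρ) {B C : Fin p → Set E}
    (hB : ∀ i, MeasurableSet (B i)) (hBfin : ∀ i, μ (B i) < ∞)
    (hBd : Pairwise fun i j => Disjoint (B i) (B j))
    (hC : ∀ i, MeasurableSet (C i)) (hCfin : ∀ i, μ (C i) < ∞)
    (hCd : Pairwise fun i j => Disjoint (C i) (C j)) :
    ∫ ω, (∏ i, M (B i) ω) * ∏ j, M (C j) ω ∂P =
      ∑ σ : Equiv.Perm (Fin p), ∏ i, μ.real (B i ∩ C (σ i)) := by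
  set D := jointAtom B C
  have hDm := measurableSet_jointAtom hB hC
  have hDf := measure_jointAtom_lt_top hBfin hCfin
  have hDd := pairwise_disjoint_jointAtom hBd hCd
  have hξ := hM.iIndepFun_of_finite hDm hDf hDd
  have horth := integral_prod_mul_prod_of_iIndepFun hξ (fun a => hM.measurable _ (hDm a) (hDf a))
    (fun a => hM.memLp hρ (hDm a) (hDf a)) fun a => hM.integral_eq_zero hρ (hDm a) (hDf a)
  have hBsum : ∀ i, M (B i) =ᵐ[P] fun ω => ∑ j, M (D (some i, j)) ω := by
    intro i
    have h := hM.ae_eq_sum hρ (B := fun j => D (some i, j)) (fun j => hDm _) (fun j => hDf _)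
      fun j j' hjj => hDd fun h => hjj (congrArg Prod.snd h)
    rwa [iUnion_jointAtom_left] at h
  have hCsum : ∀ j, M (C j) =ᵐ[P] fun ω => ∑ i, M (D (i, some j)) ω := by
    intro j
    have h := hM.ae_eq_sum hρ (B := fun i => D (i, some j)) (fun i => hDm _) (fun i => hDf _)
      fun i i' hii => hDd fun h => hii (congrArg Prod.fst h)
    rwa [iUnion_jointAtom_right] at h
  -- Each `B i` is the union of row `i` of atoms and each `C j` of column `j`. Expanding, `α` picks
  -- one atom per row and `γ` one per column.
  have hexp : (fun ω => (∏ i, M (B i) ω) * ∏ j, M (C j) ω) =ᵐ[P] fun ω =>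
      ∑ α : Fin p → Option (Fin p), ∑ γ : Fin p → Option (Fin p),
        (∏ a ∈ Finset.univ.image (fun i => (some i, α i)), M (D a) ω) *
          ∏ a ∈ Finset.univ.image (fun j => (γ j, some j)), M (D a) ω := by
    filter_upwards [ae_all_iff.2 hBsum, ae_all_iff.2 hCsum] with ω h1 h2
    simp only [h1, h2, Finset.prod_univ_sum, Fintype.piFinset_univ, Finset.sum_mul_sum]
    refine Finset.sum_congr rfl fun α _ => Finset.sum_congr rfl fun γ _ => ?_
    rw [Finset.prod_image fun i _ j _ h => Option.some_injective _ (congrArg Prod.fst h),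
      Finset.prod_image fun i _ j _ h => Option.some_injective _ (congrArg Prod.snd h)]
  rw [integral_congr_ae hexp, integral_finsetSum _ fun α _ =>
    integrable_finsetSum _ fun γ _ => (horth _ _).1]
  have hinner : ∀ α : Fin p → Option (Fin p), ∫ ω, ∑ γ : Fin p → Option (Fin p),
        (∏ a ∈ Finset.univ.image (fun i => (some i, α i)), M (D a) ω) *
          ∏ a ∈ Finset.univ.image (fun j => (γ j, some j)), M (D a) ω ∂P =
      ∑ γ : Fin p → Option (Fin p), if Finset.univ.image (fun i => (some i, α i)) =
        Finset.univ.image (fun j => (γ j, some j)) then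
          ∏ a ∈ Finset.univ.image (fun i => (some i, α i)), ∫ ω, M (D a) ω ^ 2 ∂P else 0 := by
    intro α
    rw [integral_finsetSum _ fun γ _ => (horth _ _).1]
    exact Finset.sum_congr rfl fun γ _ => (horth _ _).2
  rw [Finset.sum_congr rfl fun α _ => hinner α]
  rw [sum_matching_eq_sum_perm fun a => ∫ ω, M (D a) ω ^ 2 ∂P]
  refine Finset.sum_congr rfl fun σ _ => Finset.prod_congr rfl fun i _ => ?_
  rw [hM.integral_sq hρ (hDm _) (hDf _), jointAtom_some_some]

theorem measurePreserving_comp_perm [SigmaFinite μ] (σ : Equiv.Perm (Fin p)) :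
    MeasurePreserving (fun x : Fin p → E => x ∘ σ) (Measure.pi fun _ : Fin p => μ)
      (Measure.pi fun _ : Fin p => μ) := by
  have hm : Measurable fun x : Fin p → E => x ∘ σ :=
    measurable_pi_lambda _ fun i => measurable_pi_apply _
  refine ⟨hm, (Measure.pi_eq fun s hs => ?_).symm⟩
  have hpre : (fun x : Fin p → E => x ∘ σ) ⁻¹' Set.univ.pi s =
      Set.univ.pi fun i => s (σ.symm i) := by
    ext x
    simp only [Set.mem_preimage, Set.mem_univ_pi, Function.comp_apply]
    exact ⟨fun h i => by simpa using h (σ.symm i), fun h i => by simpa using h (σ i)⟩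
  rw [Measure.map_apply hm (MeasurableSet.univ_pi hs), hpre, Measure.pi_pi]
  exact Equiv.prod_comp σ.symm fun i => μ (s i)

theorem memLp_of_mem_elementaryIntegral [SigmaFinite μ] (hM : IsIDRandomMeasure μ ρ P M)
    (hρ : IsSymmUnitLevy ρ) {q : ((Fin p → E) → ℝ) × (Ω → ℝ)} (hq : q ∈ elementaryIntegral μ M p) :
    MemLp q.1 2 (Measure.pi fun _ : Fin p => μ) ∧ MemLp q.2 2 P := by
  induction hq using Submodule.span_induction with
  | mem q hq =>
    obtain ⟨B, hB, hBf, hBd, rfl⟩ := hq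
    refine ⟨memLp_indicator_const 2 (MeasurableSet.univ_pi hB) 1 (Or.inr ?_),
      hM.memLp_prod hρ hB hBf hBd⟩
    rw [Measure.pi_pi]
    exact (ENNReal.prod_lt_top fun i _ => hBf i).ne
  | zero => exact ⟨MemLp.zero, MemLp.zero⟩
  | add q q' _ _ h h' => exact ⟨h.1.add h'.1, h.2.add h'.2⟩
  | smul c q _ h => exact ⟨h.1.const_smul c, h.2.const_smul c⟩

/-- Both sides are bilinear, so generators suffice. Working with pairs avoids choosing a
representation of the integrand: applied to the difference of two pairs with the same integrand, the
formula shows that their integrals agree almost surely. -/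
theorem integral_mul_of_mem_elementaryIntegral [SigmaFinite μ] (hM : IsIDRandomMeasure μ ρ P M)
    (hρ : IsSymmUnitLevy ρ) {q q' : ((Fin p → E) → ℝ) × (Ω → ℝ)}
    (hq : q ∈ elementaryIntegral μ M p) (hq' : q' ∈ elementaryIntegral μ M p) :
    ∫ ω, q.2 ω * q'.2 ω ∂P = ∑ σ : Equiv.Perm (Fin p),
      ∫ x, q.1 x * q'.1 (x ∘ σ) ∂(Measure.pi fun _ : Fin p => μ) := by
  have hL := fun {r : ((Fin p → E) → ℝ) × (Ω → ℝ)} (hr : r ∈ elementaryIntegral μ M p) =>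
    memLp_of_mem_elementaryIntegral hM hρ hr
  have hi2 : ∀ {r r' : ((Fin p → E) → ℝ) × (Ω → ℝ)}, r ∈ elementaryIntegral μ M p →
      r' ∈ elementaryIntegral μ M p → Integrable (fun ω => r.2 ω * r'.2 ω) P :=
    fun hr hr' => (hL hr).2.integrable_mul (hL hr').2
  have hi1 : ∀ {r r' : ((Fin p → E) → ℝ) × (Ω → ℝ)}, r ∈ elementaryIntegral μ M p →
      r' ∈ elementaryIntegral μ M p → ∀ σ : Equiv.Perm (Fin p),
      Integrable (fun x => r.1 x * r'.1 (x ∘ σ)) (Measure.pi fun _ : Fin p => μ) :=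
    fun hr hr' σ => (hL hr).1.integrable_mul
      ((hL hr').1.comp_measurePreserving (measurePreserving_comp_perm σ))
  induction hq using Submodule.span_induction with
  | mem q hq =>
    induction hq' using Submodule.span_induction with
    | mem q' hq' =>
      obtain ⟨B, hB, hBf, hBd, rfl⟩ := hq
      obtain ⟨C, hC, hCf, hCd, rfl⟩ := hq'
      simp only
      -- Composing the argument with `σ` permutes the sides of the rectangle by `σ⁻¹`, hence the sum
      -- is reindexed by inversion.
      rw [hM.integral_prod_mul_prod hρ hB hBf hBd hC hCf hCd, ← Equiv.sum_comp (Equiv.inv _)]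
      refine Finset.sum_congr rfl fun σ _ => ?_
      have heq : (fun x : Fin p → E => (Set.univ.pi B).indicator (fun _ => (1 : ℝ)) x *
          (Set.univ.pi C).indicator (fun _ => (1 : ℝ)) (x ∘ σ)) =
          (Set.univ.pi fun i => B i ∩ C (σ⁻¹ i)).indicator fun _ => (1 : ℝ) := by
        funext x
        have hiff : x ∘ σ ∈ Set.univ.pi C ↔ x ∈ Set.univ.pi fun i => C (σ⁻¹ i) := by
          simp only [Set.mem_univ_pi, Function.comp_apply]
          exact ⟨fun h i => by simpa using h (σ⁻¹ i), fun h i => by simpa using h (σ i)⟩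
        have hcomp : (Set.univ.pi C).indicator (fun _ => (1 : ℝ)) (x ∘ σ) =
            (Set.univ.pi fun i => C (σ⁻¹ i)).indicator (fun _ => (1 : ℝ)) x := by
          by_cases h : x ∈ Set.univ.pi fun i => C (σ⁻¹ i)
          · rw [Set.indicator_of_mem h, Set.indicator_of_mem (hiff.2 h)]
          · rw [Set.indicator_of_notMem h, Set.indicator_of_notMem (mt hiff.1 h)]
        rw [Set.pi_inter_distrib, hcomp]
        exact (congrFun (Set.inter_indicator_one (M₀ := ℝ)) x).symm
      rw [heq, integral_indicator_pi fun i => (hB i).inter (hC _)]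
      rfl
    | zero => simp
    | add r r' hr hr' ih ih' =>
      have hq0 : q ∈ elementaryIntegral μ M p := Submodule.subset_span hq
      simp only [Prod.snd_add, Prod.fst_add, Pi.add_apply, mul_add]
      rw [integral_add (hi2 hq0 hr) (hi2 hq0 hr'), ih, ih', ← Finset.sum_add_distrib]
      exact Finset.sum_congr rfl fun σ _ => (integral_add (hi1 hq0 hr σ) (hi1 hq0 hr' σ)).symm
    | smul c r hr ih =>
      simp only [Prod.smul_snd, Prod.smul_fst, Pi.smul_apply, smul_eq_mul, mul_left_comm _ c,
        integral_const_mul, ← Finset.mul_sum]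
      rw [ih]
  | zero => simp
  | add r r' hr hr' ih ih' =>
    simp only [Prod.snd_add, Prod.fst_add, Pi.add_apply, add_mul]
    rw [integral_add (hi2 hr hq') (hi2 hr' hq'), ih, ih', ← Finset.sum_add_distrib]
    exact Finset.sum_congr rfl fun σ _ => (integral_add (hi1 hr hq' σ) (hi1 hr' hq' σ)).symm
  | smul c r hr ih =>
    simp only [Prod.smul_snd, Prod.smul_fst, Pi.smul_apply, smul_eq_mul, mul_assoc,
      integral_const_mul, ← Finset.mul_sum]
    rw [ih]

end Isometry

/-! ### Fine partitions in an atomless space. -/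

section Partition

variable {E : Type*} [MeasurableSpace E] {μ : Measure E}

/-- Repeated halving: when `C` is split into two parts of positive measure, one of them has at most
half the mass. -/
theorem Atomless.exists_subset_measure_le (h : Atomless μ) {B : Set E} (hB : MeasurableSet B)
    (hpos : 0 < μ B) (hfin : μ B < ∞) {ε : ℝ≥0∞} (hε : 0 < ε) :
    ∃ C ⊆ B, MeasurableSet C ∧ 0 < μ C ∧ μ C ≤ ε := by
  have hstep : ∀ n : ℕ, ∃ C ⊆ B, MeasurableSet C ∧ 0 < μ C ∧ μ C ≤ μ B * 2⁻¹ ^ n := by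
    intro n
    induction n with
    | zero => exact ⟨B, subset_rfl, hB, hpos, by simp⟩
    | succ n ih =>
      obtain ⟨C, hCB, hC, hC0, hCn⟩ := ih
      obtain ⟨D, hDC, hD, hD0, hDlt⟩ := h C hC hC0
      have hDfin : μ D ≠ ∞ := ((measure_mono (hDC.trans hCB)).trans_lt hfin).ne
      have hhalf : ∀ F : Set E, μ F ≤ μ C * 2⁻¹ → μ F ≤ μ B * 2⁻¹ ^ (n + 1) := by
        intro F hF
        refine hF.trans ?_
        rw [pow_succ, ← mul_assoc]
        gcongr
      by_cases hle : μ D ≤ μ C * 2⁻¹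
      · exact ⟨D, hDC.trans hCB, hD, hD0, hhalf D hle⟩
      · refine ⟨C \ D, Set.sdiff_subset.trans hCB, hC.diff hD, ?_, hhalf _ ?_⟩
        · rw [measure_sdiff hDC hD.nullMeasurableSet hDfin]
          exact tsub_pos_of_lt hDlt
        · rw [measure_sdiff hDC hD.nullMeasurableSet hDfin, tsub_le_iff_right]
          calc μ C = μ C * 2⁻¹ + μ C * 2⁻¹ := by
                rw [← mul_add, ENNReal.inv_two_add_inv_two, mul_one]
            _ ≤ μ C * 2⁻¹ + μ D := by gcongr; exact (not_le.1 hle).le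
  have hlim : Tendsto (fun n : ℕ => μ B * 2⁻¹ ^ n) atTop (𝓝 0) := by
    have := ENNReal.Tendsto.const_mul (a := μ B)
      (ENNReal.tendsto_pow_atTop_nhds_zero_of_lt_one (r := 2⁻¹) (by simp))
      (Or.inr hfin.ne)
    rwa [mul_zero] at this
  obtain ⟨n, hn⟩ := (hlim.eventually (gt_mem_nhds hε)).exists
  obtain ⟨C, hCB, hC, hC0, hCn⟩ := hstep n
  exact ⟨C, hCB, hC, hC0, hCn.trans hn.le⟩

/-- In an atomless space sets of finite measure split into countably many small pieces. -/
theorem Atomless.exists_partition (h : Atomless μ) {B : Set E} (hB : MeasurableSet B)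
    (hfin : μ B < ∞) {ε : ℝ≥0∞} (hε : 0 < ε) :
    ∃ D : ℕ → Set E, (∀ n, MeasurableSet (D n)) ∧ (∀ n, μ (D n) ≤ ε) ∧
      Pairwise (fun m n => Disjoint (D m) (D n)) ∧ ⋃ n, D n = B := by
  -- Exhaustion: this class is stable under countable unions, so it has a member of maximal measure.
  -- A non-null remainder would contain a small set that enlarges it. Disjointness is arranged at
  -- the end.
  let 𝒞 : Set (Set E) := {C | C ⊆ B ∧ ∃ D : ℕ → Set E, (∀ n, MeasurableSet (D n)) ∧
    (∀ n, μ (D n) ≤ ε) ∧ ⋃ n, D n = C}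
  have hsmall : ∀ C ⊆ B, MeasurableSet C → μ C ≤ ε → C ∈ 𝒞 := fun C hCB hC hCε =>
    ⟨hCB, fun _ => C, fun _ => hC, fun _ => hCε, Set.iUnion_const C⟩
  have hunion : ∀ C : ℕ → Set E, (∀ n, C n ∈ 𝒞) → ⋃ n, C n ∈ 𝒞 := by
    intro C hC
    choose D hD1 hD2 hD3 using fun n => (hC n).2
    refine ⟨Set.iUnion_subset fun n => (hC n).1, fun k => D k.unpair.1 k.unpair.2,
      fun k => hD1 _ _, fun k => hD2 _ _, ?_⟩
    rw [Set.iUnion_unpair (fun i j => D i j)]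
    exact Set.iUnion_congr hD3
  have hmeas : ∀ C ∈ 𝒞, MeasurableSet C := by
    rintro _ ⟨-, D, hD, -, rfl⟩
    exact MeasurableSet.iUnion hD
  obtain ⟨C, hC, hCmax⟩ : ∃ C ∈ 𝒞, ∀ C' ∈ 𝒞, μ C' ≤ μ C := by
    have hne : (μ '' 𝒞).Nonempty :=
      ⟨μ ∅, ∅, hsmall ∅ (Set.empty_subset _) MeasurableSet.empty (by simp), rfl⟩
    obtain ⟨u, -, hu, huC⟩ := exists_seq_tendsto_sSup hne (OrderTop.bddAbove _)
    choose C hC huC using huC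
    refine ⟨⋃ n, C n, hunion C hC, fun C' hC' => (le_sSup (Set.mem_image_of_mem μ hC')).trans ?_⟩
    refine le_of_tendsto hu (Eventually.of_forall fun n => ?_)
    rw [← huC n]
    exact measure_mono (Set.subset_iUnion C n)
  have hnull : μ (B \ C) = 0 := by
    by_contra hne
    obtain ⟨F, hF, hFm, hF0, hFε⟩ := h.exists_subset_measure_le (hB.diff (hmeas C hC))
      (pos_iff_ne_zero.2 hne) ((measure_mono Set.sdiff_subset).trans_lt hfin) hε
    have hCF : C ∪ F ∈ 𝒞 := by
      have := hunion (fun n => if n = 0 then C else F) fun n => by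
        by_cases hn : n = 0
        · simpa [hn] using hC
        · simpa [hn] using hsmall F (hF.trans Set.sdiff_subset) hFm hFε
      convert this using 1
      ext x
      simp only [Set.mem_union, Set.mem_iUnion]
      constructor
      · rintro (hx | hx)
        · exact ⟨0, by simpa using hx⟩
        · exact ⟨1, by simpa using hx⟩
      · rintro ⟨n, hn⟩
        by_cases h0 : n = 0
        · exact Or.inl (by simpa [h0] using hn)
        · exact Or.inr (by simpa [h0] using hn)
    have hle := hCmax _ hCF
    rw [measure_union (Set.disjoint_left.2 fun x hx hxF => (hF hxF).2 hx) hFm] at hle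
    have hCfin : μ C ≠ ∞ := ((measure_mono hC.1).trans_lt hfin).ne
    exact absurd hle (not_le.2 (ENNReal.lt_add_right hCfin hF0.ne'))
  have hB𝒞 : B ∈ 𝒞 := by
    have := hunion (fun n => if n = 0 then C else B \ C) fun n => by
      by_cases hn : n = 0
      · simpa [hn] using hC
      · simpa [hn] using hsmall (B \ C) Set.sdiff_subset (hB.diff (hmeas C hC)) (by simp [hnull])
    convert this using 1
    ext x
    simp only [Set.mem_iUnion]
    constructor
    · intro hx
      by_cases hxC : x ∈ C
      · exact ⟨0, by simpa using hxC⟩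
      · exact ⟨1, by simpa using ⟨hx, hxC⟩⟩
    · rintro ⟨n, hn⟩
      by_cases h0 : n = 0
      · exact hC.1 (by simpa [h0] using hn)
      · exact (show x ∈ B \ C by simpa [h0] using hn).1
  obtain ⟨-, D, hD1, hD2, hD3⟩ := hB𝒞
  exact ⟨disjointed D, fun n => MeasurableSet.disjointed hD1 n,
    fun n => (measure_mono (disjointed_subset D n)).trans (hD2 n), disjoint_disjointed D,
    by rw [iUnion_disjointed, hD3]⟩

end Partition

/-! ### Off-diagonal rectangles determine a square integrable function. -/

section Density

variable {E : Type*} [MeasurableSpace E] {μ : Measure E} [SigmaFinite μ] {p : ℕ}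

/-- Two coordinates sharing a piece cost Σ μ(D n)² ≤ ε Σ μ(D n) = ε μ(U), so a fine partition makes
a neighbourhood of the diagonal small. -/
theorem measure_pi_same_piece_le {U : Set E} {D : ℕ → Set E} {ε : ℝ≥0∞}
    (hD : ∀ n, MeasurableSet (D n)) (hDε : ∀ n, μ (D n) ≤ ε)
    (hDd : Pairwise fun m n => Disjoint (D m) (D n)) (hDU : ⋃ n, D n = U) {i j : Fin p}
    (hij : i ≠ j) :
    (Measure.pi fun _ : Fin p => μ) {x | (∀ k, x k ∈ U) ∧ ∃ n, x i ∈ D n ∧ x j ∈ D n} ≤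
      ε * (μ U * ∏ _k ∈ (Finset.univ.erase i).erase j, μ U) := by
  have hsub : {x : Fin p → E | (∀ k, x k ∈ U) ∧ ∃ n, x i ∈ D n ∧ x j ∈ D n} ⊆
      ⋃ n, Set.univ.pi fun k => if k = i ∨ k = j then D n else U := by
    rintro x ⟨hx, n, hi, hj⟩
    refine Set.mem_iUnion.2 ⟨n, fun k _ => ?_⟩
    by_cases hk : k = i ∨ k = j
    · simp only [hk, if_true]
      rcases hk with rfl | rfl <;> assumption
    · simpa only [hk, if_false] using hx k
  refine (measure_mono hsub).trans ((measure_iUnion_le _).trans ?_)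
  have hterm : ∀ n, (Measure.pi fun _ : Fin p => μ)
      (Set.univ.pi fun k => if k = i ∨ k = j then D n else U) ≤
      μ (D n) * (ε * ∏ _k ∈ (Finset.univ.erase i).erase j, μ U) := by
    intro n
    rw [Measure.pi_pi, ← Finset.mul_prod_erase _ _ (Finset.mem_univ i),
      ← Finset.mul_prod_erase _ _ (Finset.mem_erase.2 ⟨hij.symm, Finset.mem_univ j⟩)]
    simp only [true_or, or_true, if_true]
    gcongr with k hk
    · exact hDε n
    · rw [Finset.mem_erase, Finset.mem_erase] at hk
      simp [hk.1, hk.2.1]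
  refine (ENNReal.tsum_le_tsum hterm).trans (le_of_eq ?_)
  rw [ENNReal.tsum_mul_right, ← measure_iUnion hDd hD, hDU]
  ring

/-- A function with vanishing integrals over the off-diagonal rectangles has vanishing integrals
over all rectangles. -/
theorem setIntegral_pi_eq_zero_of_offDiagonal (h : Atomless μ) {g : (Fin p → E) → ℝ}
    (hg : MemLp g 2 (Measure.pi fun _ : Fin p => μ))
    (h0 : ∀ B : Fin p → Set E, (∀ i, MeasurableSet (B i)) → (∀ i, μ (B i) < ∞) →
      Pairwise (fun i j => Disjoint (B i) (B j)) →
      ∫ x in Set.univ.pi B, g x ∂(Measure.pi fun _ : Fin p => μ) = 0)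
    {B : Fin p → Set E} (hB : ∀ i, MeasurableSet (B i)) (hfin : ∀ i, μ (B i) < ∞) :
    ∫ x in Set.univ.pi B, g x ∂(Measure.pi fun _ : Fin p => μ) = 0 := by
  set m := Measure.pi fun _ : Fin p => μ with hm
  set U : Set E := ⋃ i, B i with hU
  have hUm : MeasurableSet U := MeasurableSet.iUnion hB
  have hUfin : μ U < ∞ := by
    refine (measure_iUnion_le _).trans_lt ?_
    rw [tsum_fintype]
    exact ENNReal.sum_lt_top.2 fun i _ => hfin i
  have hRm : MeasurableSet (Set.univ.pi B) := MeasurableSet.univ_pi hB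
  have hRfin : m (Set.univ.pi B) < ∞ := by
    rw [hm, Measure.pi_pi]
    exact ENNReal.prod_lt_top fun i _ => hfin i
  have : IsFiniteMeasure (m.restrict (Set.univ.pi B)) := ⟨by simpa using hRfin⟩
  have hgR : IntegrableOn g (Set.univ.pi B) m :=
    (hg.restrict (Set.univ.pi B)).integrable one_le_two
  set c : ℝ≥0∞ := ∑ a : Fin p × Fin p, μ U * ∏ _k ∈ (Finset.univ.erase a.1).erase a.2, μ U with hc
  have hcfin : c ≠ ∞ := by
    refine (ENNReal.sum_lt_top.2 fun a _ => ENNReal.mul_lt_top hUfin ?_).ne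
    exact ENNReal.prod_lt_top fun _ _ => hUfin
  have key : ∀ N : ℕ, ∃ Z : Set (Fin p → E), MeasurableSet Z ∧ Z ⊆ Set.univ.pi B ∧
      m Z ≤ ((N : ℝ≥0∞) + 1)⁻¹ * c ∧
      ∫ x in Set.univ.pi B, g x ∂m = ∫ x in Z, g x ∂m := by
    intro N
    obtain ⟨D, hDm, hDε, hDd, hDU⟩ := h.exists_partition hUm hUfin
      (ε := ((N : ℝ≥0∞) + 1)⁻¹) (by simp)
    -- Injective labels place the coordinates in different pieces, so these subrectangles have
    -- disjoint sides and `g` integrates to 0 over each. The rest of the rectangle has two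
    -- coordinates in a common piece.
    let R : {ν : Fin p → ℕ // Function.Injective ν} → Set (Fin p → E) :=
      fun ν => Set.univ.pi fun i => B i ∩ D (ν.1 i)
    have hRνm : ∀ ν, MeasurableSet (R ν) := fun ν =>
      MeasurableSet.univ_pi fun i => (hB i).inter (hDm _)
    have hRsub : ∀ ν, R ν ⊆ Set.univ.pi B := fun ν => Set.pi_mono fun i _ => Set.inter_subset_left
    have hRd : Pairwise (Function.onFun Disjoint R) := by
      intro ν ν' hne
      obtain ⟨i, hi⟩ : ∃ i, ν.1 i ≠ ν'.1 i := by
        by_contra hcon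
        push Not at hcon
        exact hne (Subtype.ext (funext hcon))
      exact Set.disjoint_left.2 fun x hx hx' => Set.disjoint_left.1 (hDd hi)
        (hx i (Set.mem_univ i)).2 (hx' i (Set.mem_univ i)).2
    have hGm : MeasurableSet (⋃ ν, R ν) := MeasurableSet.iUnion hRνm
    have hGsub : (⋃ ν, R ν) ⊆ Set.univ.pi B := Set.iUnion_subset hRsub
    have hG0 : ∫ x in ⋃ ν, R ν, g x ∂m = 0 := by
      rw [integral_iUnion hRνm hRd (hgR.mono_set hGsub)]
      have : ∀ ν, ∫ x in R ν, g x ∂m = 0 := fun ν =>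
        h0 _ (fun i => (hB i).inter (hDm _))
          (fun i => (measure_mono Set.inter_subset_left).trans_lt (hfin i))
          fun i j hij => (hDd (ν.2.ne hij)).mono Set.inter_subset_right Set.inter_subset_right
      simp [this]
    refine ⟨Set.univ.pi B \ ⋃ ν, R ν, hRm.diff hGm, Set.sdiff_subset, ?_, ?_⟩
    · have hsub : Set.univ.pi B \ ⋃ ν, R ν ⊆ ⋃ a : Fin p × Fin p,
          if a.1 = a.2 then ∅ else
            {x : Fin p → E | (∀ k, x k ∈ U) ∧ ∃ n, x a.1 ∈ D n ∧ x a.2 ∈ D n} := by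
        rintro x ⟨hxB, hxG⟩
        have hxU : ∀ k, x k ∈ U := fun k => Set.mem_iUnion.2 ⟨k, hxB k (Set.mem_univ k)⟩
        have hxD : ∀ k, ∃ n, x k ∈ D n := fun k => Set.mem_iUnion.1 (hDU ▸ hxU k)
        choose ν hν using hxD
        have hninj : ¬Function.Injective ν := fun hinj =>
          hxG (Set.mem_iUnion.2 ⟨⟨ν, hinj⟩, fun i _ => ⟨hxB i (Set.mem_univ i), hν i⟩⟩)
        obtain ⟨i, j, hνij, hij⟩ : ∃ i j, ν i = ν j ∧ i ≠ j := by
          simpa [Function.Injective] using hninj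
        refine Set.mem_iUnion.2 ⟨(i, j), ?_⟩
        simp only [hij, if_false]
        exact ⟨hxU, ν i, hν i, hνij ▸ hν j⟩
      refine (measure_mono hsub).trans ((measure_iUnion_le _).trans ?_)
      rw [tsum_fintype, hc, Finset.mul_sum]
      refine Finset.sum_le_sum fun a _ => ?_
      by_cases ha : a.1 = a.2
      · simp [ha]
      · simp only [ha, if_false]
        exact measure_pi_same_piece_le hDm hDε hDd hDU ha
    · rw [setIntegral_sdiff hGm hgR hGsub, hG0, sub_zero]
  choose Z hZm hZsub hZle hZint using key
  have hZlim : Tendsto (fun N => m.restrict (Set.univ.pi B) (Z N)) atTop (𝓝 0) := by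
    have hinv : Tendsto (fun N : ℕ => ((N : ℝ≥0∞) + 1)⁻¹ * c) atTop (𝓝 0) := by
      have h1 : Tendsto (fun N : ℕ => (((N + 1 : ℕ) : ℝ≥0∞))⁻¹) atTop (𝓝 0) :=
        ENNReal.tendsto_inv_nat_nhds_zero.comp (tendsto_add_atTop_nat 1)
      have h2 := ENNReal.Tendsto.mul_const h1 (Or.inr hcfin)
      simpa using h2
    refine tendsto_of_tendsto_of_tendsto_of_le_of_le tendsto_const_nhds hinv
      (fun _ => zero_le) fun N => ?_
    exact (Measure.restrict_apply_le _ _).trans (hZle N)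
  have hlim := Integrable.tendsto_setIntegral_nhds_zero hgR.integrable hZlim
  refine tendsto_nhds_unique (tendsto_const_nhds.congr fun N => ?_) hlim
  rw [hZint N, Measure.restrict_restrict (hZm N), Set.inter_eq_left.2 (hZsub N)]

theorem ae_eq_zero_of_offDiagonal (h : Atomless μ) {g : (Fin p → E) → ℝ}
    (hg : MemLp g 2 (Measure.pi fun _ : Fin p => μ))
    (h0 : ∀ B : Fin p → Set E, (∀ i, MeasurableSet (B i)) → (∀ i, μ (B i) < ∞) →
      Pairwise (fun i j => Disjoint (B i) (B j)) →
      ∫ x in Set.univ.pi B, g x ∂(Measure.pi fun _ : Fin p => μ) = 0) :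
    g =ᵐ[Measure.pi fun _ : Fin p => μ] 0 := by
  set m := Measure.pi fun _ : Fin p => μ with hm
  -- On a box of finite measure `g` is integrable, and a π-λ argument passes from rectangles to all
  -- measurable sets.
  have hbox : ∀ n : ℕ, ∀ᵐ x ∂m, x ∈ Set.univ.pi (fun _ : Fin p => spanningSets μ n) → g x = 0 := by
    intro n
    set Q : Set (Fin p → E) := Set.univ.pi fun _ => spanningSets μ n with hQ
    have hQm : MeasurableSet Q := MeasurableSet.univ_pi fun _ => measurableSet_spanningSets μ n
    have hQfin : m Q < ∞ := by
      rw [hm, hQ, Measure.pi_pi]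
      exact ENNReal.prod_lt_top fun _ _ => measure_spanningSets_lt_top μ n
    have : IsFiniteMeasure (m.restrict Q) := ⟨by simpa using hQfin⟩
    have hgQ : Integrable g (m.restrict Q) := (hg.restrict Q).integrable one_le_two
    have hrect : ∀ B : Fin p → Set E, (∀ i, MeasurableSet (B i)) →
        ∫ x in Set.univ.pi B, g x ∂(m.restrict Q) = 0 := by
      intro B hB
      rw [Measure.restrict_restrict (MeasurableSet.univ_pi hB), hQ, ← Set.pi_inter_distrib]
      exact setIntegral_pi_eq_zero_of_offDiagonal h hg h0
        (fun i => (hB i).inter (measurableSet_spanningSets μ n))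
        fun i => (measure_mono Set.inter_subset_right).trans_lt (measure_spanningSets_lt_top μ n)
    have huniv : ∫ x, g x ∂(m.restrict Q) = 0 := by
      have := hrect (fun _ => Set.univ) fun _ => MeasurableSet.univ
      rwa [Set.pi_univ, setIntegral_univ] at this
    rw [← ae_restrict_iff' hQm]
    refine hgQ.ae_eq_zero_of_forall_setIntegral_eq_zero fun s hs _ => ?_
    refine MeasurableSpace.induction_on_inter
      (C := fun s _ => ∫ x in s, g x ∂(m.restrict Q) = 0) generateFrom_pi.symm isPiSystem_pi
      ?_ ?_ ?_ ?_ s hs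
    · simp
    · rintro _ ⟨B, hB, rfl⟩
      exact hrect B fun i => hB i (Set.mem_univ i)
    · intro t htm ih
      have := integral_add_compl htm hgQ
      rwa [ih, huniv, zero_add] at this
    · intro t htd htm ih
      rw [integral_iUnion htm htd hgQ.integrableOn]
      simp [ih]
  filter_upwards [ae_all_iff.2 hbox] with x hx
  have hex : ∀ k, ∃ n, x k ∈ spanningSets μ n := fun k =>
    Set.mem_iUnion.1 ((iUnion_spanningSets μ).symm ▸ Set.mem_univ (x k))
  choose ν hν using hex
  obtain ⟨n, hn⟩ := (Set.finite_range ν).bddAbove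
  exact hx n fun k _ => monotone_spanningSets μ (hn ⟨k, rfl⟩) (hν k)

end Density

/-! ### Inner products and limits in L². -/

section LTwo

variable {X : Type*} [MeasurableSpace X] {ν : Measure X}

theorem inner_toLp_eq_integral {f g : X → ℝ} (hf : MemLp f 2 ν) (hg : MemLp g 2 ν) :
    inner ℝ (hf.toLp f) (hg.toLp g) = ∫ x, f x * g x ∂ν := by
  rw [L2.inner_def]
  refine integral_congr_ae ?_
  filter_upwards [hf.coeFn_toLp, hg.coeFn_toLp] with x h1 h2
  rw [h1, h2]
  simp [mul_comm]

theorem tendsto_toLp_of_tendsto_eLpNorm {f : ℕ → X → ℝ} {g : X → ℝ} (hf : ∀ n, MemLp (f n) 2 ν)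
    (hg : MemLp g 2 ν) (h : Tendsto (fun n => eLpNorm (f n - g) 2 ν) atTop (𝓝 0)) :
    Tendsto (fun n => (hf n).toLp (f n)) atTop (𝓝 (hg.toLp g)) :=
  (Lp.tendsto_Lp_iff_tendsto_eLpNorm'' f hf g hg).2 h

theorem tendsto_integral_mul_of_tendsto_eLpNorm {f f' : ℕ → X → ℝ} {g g' : X → ℝ}
    (hf : ∀ n, MemLp (f n) 2 ν) (hg : MemLp g 2 ν)
    (h : Tendsto (fun n => eLpNorm (f n - g) 2 ν) atTop (𝓝 0))
    (hf' : ∀ n, MemLp (f' n) 2 ν) (hg' : MemLp g' 2 ν)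
    (h' : Tendsto (fun n => eLpNorm (f' n - g') 2 ν) atTop (𝓝 0)) :
    Tendsto (fun n => ∫ x, f n x * f' n x ∂ν) atTop (𝓝 (∫ x, g x * g' x ∂ν)) := by
  have := (tendsto_toLp_of_tendsto_eLpNorm hf hg h).inner (𝕜 := ℝ)
    (tendsto_toLp_of_tendsto_eLpNorm hf' hg' h')
  simpa only [inner_toLp_eq_integral] using this

end LTwo

/-! ### Density of elementary integrands. -/

section ElementaryApproximation

variable {E Ω : Type*} [MeasurableSpace E] {μ : Measure E} {M : Set E → Ω → ℝ} {p : ℕ}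

/-- The classes of the elementary integrands. -/
def elementaryLp (μ : Measure E) [SigmaFinite μ] (M : Set E → Ω → ℝ) (p : ℕ) :
    Submodule ℝ (Lp ℝ 2 (Measure.pi fun _ : Fin p => μ)) where
  carrier := {v | ∃ q ∈ elementaryIntegral μ M p, v =ᵐ[Measure.pi fun _ : Fin p => μ] q.1}
  add_mem' := by
    rintro v w ⟨q, hq, hv⟩ ⟨r, hr, hw⟩
    exact ⟨q + r, Submodule.add_mem _ hq hr, (Lp.coeFn_add v w).trans (hv.add hw)⟩
  zero_mem' := ⟨0, Submodule.zero_mem _, Lp.coeFn_zero _ _ _⟩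
  smul_mem' := by
    rintro c v ⟨q, hq, hv⟩
    exact ⟨c • q, Submodule.smul_mem _ _ hq, (Lp.coeFn_smul c v).trans (hv.const_smul c)⟩

/-- A vector orthogonal to the subspace has zero integral over every off-diagonal rectangle, hence
vanishes. -/
theorem topologicalClosure_elementaryLp [SigmaFinite μ] (h : Atomless μ) :
    (elementaryLp μ M p).topologicalClosure = ⊤ := by
  rw [Submodule.topologicalClosure_eq_top_iff, Submodule.eq_bot_iff]
  intro v hv
  rw [Submodule.mem_orthogonal] at hv
  rw [Lp.eq_zero_iff_ae_eq_zero]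
  refine ae_eq_zero_of_offDiagonal h (Lp.memLp v) fun B hB hBf hBd => ?_
  have hm : MeasurableSet (Set.univ.pi B) := MeasurableSet.univ_pi hB
  have hfin : (Measure.pi fun _ : Fin p => μ) (Set.univ.pi B) ≠ ∞ := by
    rw [Measure.pi_pi]
    exact (ENNReal.prod_lt_top fun i _ => hBf i).ne
  rw [← L2.inner_indicatorConstLp_one (𝕜 := ℝ) hm hfin v]
  refine hv _ ⟨_, Submodule.subset_span ⟨B, hB, hBf, hBd, rfl⟩, ?_⟩
  exact indicatorConstLp_coeFn

theorem exists_elementary_approx [SigmaFinite μ] (hμ : Atomless μ) (M : Set E → Ω → ℝ)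
    {h : (Fin p → E) → ℝ} (hh : MemLp h 2 (Measure.pi fun _ : Fin p => μ)) :
    ∃ q : ℕ → ((Fin p → E) → ℝ) × (Ω → ℝ), (∀ n, q n ∈ elementaryIntegral μ M p) ∧
      Tendsto (fun n => eLpNorm ((q n).1 - h) 2 (Measure.pi fun _ : Fin p => μ)) atTop (𝓝 0) := by
  have hmem : hh.toLp h ∈ closure (elementaryLp μ M p : Set (Lp ℝ 2 (Measure.pi fun _ => μ))) := by
    rw [← Submodule.topologicalClosure_coe, topologicalClosure_elementaryLp hμ]
    trivial
  obtain ⟨v, hv, hlim⟩ := mem_closure_iff_seq_limit.1 hmem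
  choose q hq hvq using hv
  refine ⟨q, hq, ?_⟩
  rw [Lp.tendsto_Lp_iff_tendsto_eLpNorm'] at hlim
  refine hlim.congr fun n => eLpNorm_congr_ae ?_
  exact (hvq n).sub hh.coeFn_toLp

end ElementaryApproximation

/-! ### Existence and covariance of multiple integrals. -/

section MultipleIntegral

variable {E Ω : Type*} [MeasurableSpace E] [MeasurableSpace Ω] {μ : Measure E} {ρ : Measure ℝ}
  {P : Measure Ω} {M : Set E → Ω → ℝ} {p : ℕ}

theorem integral_mul_comp_perm_le [SigmaFinite μ] {g : (Fin p → E) → ℝ}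
    (hg : MemLp g 2 (Measure.pi fun _ : Fin p => μ)) (σ : Equiv.Perm (Fin p)) :
    ∫ x, g x * g (x ∘ σ) ∂(Measure.pi fun _ : Fin p => μ) ≤
      ∫ x, g x * g x ∂(Measure.pi fun _ : Fin p => μ) := by
  have hσ := measurePreserving_comp_perm (μ := μ) σ
  have hgσ := hg.comp_measurePreserving hσ
  have hsq : ∫ x, g (x ∘ σ) * g (x ∘ σ) ∂(Measure.pi fun _ : Fin p => μ) =
      ∫ x, g x * g x ∂(Measure.pi fun _ : Fin p => μ) := by
    have h := (inner_toLp_eq_integral hgσ hgσ).symm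
    rw [real_inner_self_eq_norm_sq, Lp.norm_toLp, eLpNorm_comp_measurePreserving hg.1 hσ,
      ← Lp.norm_toLp g hg, ← real_inner_self_eq_norm_sq, inner_toLp_eq_integral] at h
    exact h
  have h1 : Integrable (fun x => g x * g x) (Measure.pi fun _ : Fin p => μ) := hg.integrable_mul hg
  have h2 : Integrable (fun x => g (x ∘ σ) * g (x ∘ σ)) (Measure.pi fun _ : Fin p => μ) :=
    hgσ.integrable_mul hgσ
  calc ∫ x, g x * g (x ∘ σ) ∂(Measure.pi fun _ : Fin p => μ)
      ≤ ∫ x, (g x * g x / 2 + g (x ∘ σ) * g (x ∘ σ) / 2) ∂(Measure.pi fun _ : Fin p => μ) := by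
        refine integral_mono (hg.integrable_mul hgσ) ((h1.div_const 2).add (h2.div_const 2)) ?_
        intro x
        simp only
        nlinarith [sq_nonneg (g x - g (x ∘ σ))]
    _ = _ := by
        rw [integral_add (h1.div_const 2) (h2.div_const 2), integral_div, integral_div, hsq]
        ring

/-- Each of the p! permutation terms is at most the squared norm of the integrand. Consequently, L²
convergence of integrands makes their integrals Cauchy. -/
theorem norm_toLp_le_of_mem_elementaryIntegral [SigmaFinite μ] [IsProbabilityMeasure P]
    (hM : IsIDRandomMeasure μ ρ P M) (hρ : IsSymmUnitLevy ρ)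
    {q : ((Fin p → E) → ℝ) × (Ω → ℝ)} (hq : q ∈ elementaryIntegral μ M p)
    (h1 : MemLp q.1 2 (Measure.pi fun _ : Fin p => μ)) (h2 : MemLp q.2 2 P) :
    ‖h2.toLp q.2‖ ≤ √(p ! : ℝ) * ‖h1.toLp q.1‖ := by
  refine (sq_le_sq₀ (by positivity) (by positivity)).1 ?_
  rw [mul_pow, Real.sq_sqrt (by positivity), ← real_inner_self_eq_norm_sq,
    ← real_inner_self_eq_norm_sq, inner_toLp_eq_integral, inner_toLp_eq_integral,
    integral_mul_of_mem_elementaryIntegral hM hρ hq hq]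
  refine (Finset.sum_le_sum fun σ _ => integral_mul_comp_perm_le h1 σ).trans (le_of_eq ?_)
  rw [Finset.sum_const, Finset.card_univ, Fintype.card_perm, Fintype.card_fin, nsmul_eq_mul]

/-- Square integrable functions have an off-diagonal multiple integral. -/
theorem exists_isMultipleIntegral [SigmaFinite μ] [IsProbabilityMeasure P] (hμ : Atomless μ)
    (hM : IsIDRandomMeasure μ ρ P M) (hρ : IsSymmUnitLevy ρ)
    {h : (Fin p → E) → ℝ} (hh : MemLp h 2 (Measure.pi fun _ : Fin p => μ)) :
    ∃ X : Ω → ℝ, IsMultipleIntegral μ P M h X := by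
  obtain ⟨q, hq, hlim⟩ := exists_elementary_approx hμ M hh
  have h1 := fun n => (memLp_of_mem_elementaryIntegral hM hρ (hq n)).1
  have h2 := fun n => (memLp_of_mem_elementaryIntegral hM hρ (hq n)).2
  have hC1 : CauchySeq fun n => (h1 n).toLp (q n).1 :=
    (tendsto_toLp_of_tendsto_eLpNorm h1 hh hlim).cauchySeq
  have hdist : ∀ k n, dist ((h2 k).toLp (q k).2) ((h2 n).toLp (q n).2) ≤
      √(p ! : ℝ) * dist ((h1 k).toLp (q k).1) ((h1 n).toLp (q n).1) := by
    intro k n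
    rw [dist_eq_norm, dist_eq_norm, ← MemLp.toLp_sub, ← MemLp.toLp_sub]
    exact norm_toLp_le_of_mem_elementaryIntegral hM hρ (Submodule.sub_mem _ (hq k) (hq n)) _ _
  have hC2 : CauchySeq fun n => (h2 n).toLp (q n).2 := by
    have hpos : 0 < √(p ! : ℝ) := by positivity
    rw [Metric.cauchySeq_iff] at hC1 ⊢
    intro ε hε
    obtain ⟨N, hN⟩ := hC1 (ε / √(p ! : ℝ)) (by positivity)
    refine ⟨N, fun k hk n hn => (hdist k n).trans_lt ?_⟩
    rw [← lt_div_iff₀' hpos]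
    exact hN k hk n hn
  obtain ⟨Y, hY⟩ := cauchySeq_tendsto_of_complete hC2
  refine ⟨Y, hh, Lp.memLp Y, q, hq, hlim, ?_⟩
  rw [Lp.tendsto_Lp_iff_tendsto_eLpNorm'] at hY
  exact hY.congr fun n => eLpNorm_congr_ae ((h2 n).coeFn_toLp.sub EventuallyEq.rfl)

theorem isMultipleIntegral_multipleIntegral [SigmaFinite μ] [IsProbabilityMeasure P]
    (hμ : Atomless μ) (hM : IsIDRandomMeasure μ ρ P M) (hρ : IsSymmUnitLevy ρ)
    {h : (Fin p → E) → ℝ} (hh : MemLp h 2 (Measure.pi fun _ : Fin p => μ)) :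
    IsMultipleIntegral μ P M h (multipleIntegral μ P M h) := by
  have hex := exists_isMultipleIntegral hμ hM hρ hh
  rw [multipleIntegral, dif_pos hex]
  exact hex.choose_spec

theorem IsMultipleIntegral.congr_ae {h : (Fin p → E) → ℝ} {X Y : Ω → ℝ}
    (hX : IsMultipleIntegral μ P M h X) (hXY : Y =ᵐ[P] X) : IsMultipleIntegral μ P M h Y := by
  obtain ⟨h1, h2, q, hq, hlim, hlim2⟩ := hX
  refine ⟨h1, (memLp_congr_ae hXY).2 h2, q, hq, hlim, hlim2.congr fun n => ?_⟩
  exact eLpNorm_congr_ae (EventuallyEq.rfl.sub hXY.symm)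

/-- The isometry property of off-diagonal multiple integrals. -/
theorem IsMultipleIntegral.integral_mul [SigmaFinite μ] [IsProbabilityMeasure P]
    (hM : IsIDRandomMeasure μ ρ P M) (hρ : IsSymmUnitLevy ρ) {h h' : (Fin p → E) → ℝ}
    {X X' : Ω → ℝ} (hX : IsMultipleIntegral μ P M h X) (hX' : IsMultipleIntegral μ P M h' X') :
    ∫ ω, X ω * X' ω ∂P = ∑ σ : Equiv.Perm (Fin p),
      ∫ x, h x * h' (x ∘ σ) ∂(Measure.pi fun _ : Fin p => μ) := by
  obtain ⟨hh, hX2, q, hq, hlim, hlim2⟩ := hX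
  obtain ⟨hh', hX2', q', hq', hlim', hlim2'⟩ := hX'
  have hL := fun n => memLp_of_mem_elementaryIntegral hM hρ (hq n)
  have hL' := fun n => memLp_of_mem_elementaryIntegral hM hρ (hq' n)
  have ht := tendsto_integral_mul_of_tendsto_eLpNorm (fun n => (hL n).2) hX2 hlim2
    (fun n => (hL' n).2) hX2' hlim2'
  refine tendsto_nhds_unique ht ?_
  simp only [integral_mul_of_mem_elementaryIntegral hM hρ (hq _) (hq' _)]
  refine tendsto_finsetSum _ fun σ _ => ?_
  have hσ := measurePreserving_comp_perm (μ := μ) σ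
  refine tendsto_integral_mul_of_tendsto_eLpNorm (fun n => (hL n).1) hh hlim
    (fun n => (hL' n).1.comp_measurePreserving hσ) (hh'.comp_measurePreserving hσ) ?_
  refine hlim'.congr fun n => ?_
  exact (eLpNorm_comp_measurePreserving ((hL' n).1.sub hh').1 hσ).symm

end MultipleIntegral

end ErgodicChaos

/-! ### Covariance asymptotics of the stationary sequence. -/

theorem corollary3p1 {E Ω : Type*} [MeasurableSpace E] [MeasurableSpace Ω]
    -- the infinite measure space and the ergodic conservative transform
    (μ : Measure E) [SigmaFinite μ] (hμ_inf : μ Set.univ = ∞)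
    (hμ_atomless : ErgodicChaos.Atomless μ)
    (T : E → E) (hT_erg : Ergodic T μ) (hT_cons : Conservative T μ)
    -- the distinguished Polish subspace and the rate sequence
    (A : Set E) (hA : MeasurableSet A) (hA_pos : 0 < μ A) (hA_fin : μ A < ∞)
    [TopologicalSpace A] [PolishSpace A] [BorelSpace A]
    (β : ℝ) (hβ : β ∈ Set.Ioo (0 : ℝ) 1) (b : ℕ → ℝ)
    (hb : ErgodicChaos.RegularlyVarying b (1 - β))
    (hret : ErgodicChaos.UniformReturn μ T A b)
    -- the infinitely divisible random measure
    (P : Measure Ω) [IsProbabilityMeasure P]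
    (ρ : Measure ℝ) (hρ : ErgodicChaos.IsSymmUnitLevy ρ)
    (M : Set E → Ω → ℝ) (hM : ErgodicChaos.IsIDRandomMeasure μ ρ P M)
    -- the integrand
    (p : ℕ) (hp : 1 ≤ p) (f : (Fin p → A) → ℝ)
    (hf_symm : ∀ (σ : Equiv.Perm (Fin p)) (y : Fin p → A), f (y ∘ σ) = f y)
    (hf_bdd : ∃ K : ℝ, ∀ y, |f y| ≤ K)
    (hf_cont : ∀ᵐ y ∂(Measure.pi fun _ : Fin p => μ.comap (Subtype.val : A → E)),
      ContinuousAt f y)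
    -- the stationary sequence
    (X : ℕ → Ω → ℝ)
    (hX : ∀ k, X k =ᵐ[P] ErgodicChaos.multipleIntegral μ P M
      (ErgodicChaos.extendZeroPi f ∘ ErgodicChaos.prodIter T p k)) :
    -- the multiple integrals exist in `L²`
    (∀ k, ErgodicChaos.IsMultipleIntegral μ P M
      (ErgodicChaos.extendZeroPi f ∘ ErgodicChaos.prodIter T p k) (X k)) ∧
    -- the covariance formula
    (∀ k, Integrable (fun ω => X k ω * X 0 ω) P ∧
      Integrable (fun x => ErgodicChaos.extendZeroPi f (ErgodicChaos.prodIter T p k x) *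
        ErgodicChaos.extendZeroPi f x) (Measure.pi fun _ : Fin p => μ) ∧
      ∫ ω, X k ω * X 0 ω ∂P = (p ! : ℝ) *
        ∫ x, ErgodicChaos.extendZeroPi f (ErgodicChaos.prodIter T p k x) *
          ErgodicChaos.extendZeroPi f x ∂(Measure.pi fun _ : Fin p => μ)) ∧
    -- the limit, whether or not the integral of `f` vanishes
    Tendsto (fun k => b k ^ p * ∫ ω, X k ω * X 0 ω ∂P) atTop
      (𝓝 ((p ! : ℝ) *
        (∫ x, ErgodicChaos.extendZeroPi f x ∂(Measure.pi fun _ : Fin p => μ)) ^ 2)) ∧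
    -- asymptotic equivalence and regular variation, when the integral of `f` is nonzero
    (∫ x, ErgodicChaos.extendZeroPi f x ∂(Measure.pi fun _ : Fin p => μ) ≠ 0 →
      Tendsto (fun k => (∫ ω, X k ω * X 0 ω ∂P) /
        ((p ! : ℝ) * (∫ x, ErgodicChaos.extendZeroPi f x ∂(Measure.pi fun _ : Fin p => μ)) ^ 2 *
          (b k ^ p)⁻¹)) atTop (𝓝 1) ∧
      ErgodicChaos.RegularlyVarying (fun k => (p ! : ℝ) *
        (∫ x, ErgodicChaos.extendZeroPi f x ∂(Measure.pi fun _ : Fin p => μ)) ^ 2 *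
          (b k ^ p)⁻¹) ((p : ℝ) * (β - 1)) ∧
      ErgodicChaos.RegularlyVarying (fun k => ∫ ω, X k ω * X 0 ω ∂P) ((p : ℝ) * (β - 1))) := by
  obtain ⟨K, hK⟩ := hf_bdd
  have hne : A.Nonempty := nonempty_of_measure_ne_zero hA_pos.ne'
  have hT := hT_erg.toMeasurePreserving
  set m : Measure (Fin p → E) := Measure.pi fun _ : Fin p => μ with hm
  have hL := fun k => ErgodicChaos.memLp_extendZeroPi_comp_prodIter hT hA hA_fin hne hK hf_cont 2 k
  have hMI : ∀ k, ErgodicChaos.IsMultipleIntegral μ P M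
      (ErgodicChaos.extendZeroPi f ∘ ErgodicChaos.prodIter T p k) (X k) := fun k =>
    (ErgodicChaos.isMultipleIntegral_multipleIntegral hμ_atomless hM hρ (hL k)).congr_ae (hX k)
  have hcov : ∀ k, ∫ ω, X k ω * X 0 ω ∂P = (p ! : ℝ) *
      ∫ x, ErgodicChaos.extendZeroPi f (ErgodicChaos.prodIter T p k x) *
        ErgodicChaos.extendZeroPi f x ∂m := by
    intro k
    rw [(hMI k).integral_mul hM hρ (hMI 0)]
    -- Only the time-0 factor is permuted, so symmetry of `f` makes all p! terms equal.
    have h0 : ∀ (σ : Equiv.Perm (Fin p)) (x : Fin p → E),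
        (ErgodicChaos.extendZeroPi f ∘ ErgodicChaos.prodIter T p 0) (x ∘ σ) =
          ErgodicChaos.extendZeroPi f x :=
      fun σ x => ErgodicChaos.extendZeroPi_comp_perm hf_symm σ x
    simp only [h0, Finset.sum_const, Finset.card_univ, Fintype.card_perm, Fintype.card_fin,
      nsmul_eq_mul]
    rfl
  have hlim : Tendsto (fun k => b k ^ p * ∫ ω, X k ω * X 0 ω ∂P) atTop
      (𝓝 ((p ! : ℝ) * (∫ x, ErgodicChaos.extendZeroPi f x ∂m) ^ 2)) := by
    simp only [hcov, mul_left_comm _ (p ! : ℝ)]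
    exact (ErgodicChaos.tendsto_return_extendZeroPi hT hA hA_fin hne hb.1 hret hK
      hf_cont).const_mul _
  refine ⟨hMI, fun k => ⟨(hMI k).2.1.integrable_mul (hMI 0).2.1,
    (hL k).integrable_mul (hL 0), hcov k⟩, hlim, fun hI => ?_⟩
  have hc : 0 < (p ! : ℝ) * (∫ x, ErgodicChaos.extendZeroPi f x ∂m) ^ 2 := by positivity
  have hratio : Tendsto (fun k => (∫ ω, X k ω * X 0 ω ∂P) /
      ((p ! : ℝ) * (∫ x, ErgodicChaos.extendZeroPi f x ∂m) ^ 2 * (b k ^ p)⁻¹)) atTop (𝓝 1) := by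
    have h := hlim.div_const ((p ! : ℝ) * (∫ x, ErgodicChaos.extendZeroPi f x ∂m) ^ 2)
    rw [div_self hc.ne'] at h
    refine h.congr fun k => ?_
    simp only [div_eq_mul_inv, mul_inv, inv_inv]
    ring
  have hRV := hb.const_mul_inv_pow hc p
  rw [neg_sub] at hRV
  exact ⟨hratio, hRV, hRV.of_tendsto_div_one hratio⟩
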